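/- For $\lambda\in\mathbb{C}\setminus\{0\}$ let $f_\lambda:\mathbb{C}\to\mathbb{C}$, $f_\lambda(z)=\lambda e^z$. The Julia set $J(f_\lambda)$ is the set of points of $\mathbb{C}$ that have no neighbourhood on which the iterates $(f_\lambda^n)_{n\ge 0}$ form a normal family (convergence to $\infty$ being allowed). For $z\in\mathbb{C}$ let $\omega(z)\subset\widehat{\mathbb{C}}=\mathbb{C}\cup\{\infty\}$ be the $\omega$-limit set of $z$ in the Riemann sphere, and let $\mathcal{P}(f_\lambda)=\{\infty\}\cup\overline{\{f_\lambda^n(0):n\ge 0\}}$ be the post-singular set. Suppose that $\lambda\neq 0$ satisfies (i) $J(f_\lambda)=\mathbb{C}$; (ii) the forward orbit $\{f_\lambda^n(0):n\ge 0\}$ is bounded in $\mathbb{C}$; (iii) the set of $z\in\mathbb{C}$ with $\omega(z)\not\subset\mathcal{P}(f_\lambda)$ has positive Lebesgue measure. Then $f_\lambda$ has a nonzero $\sigma$-finite invariant Borel measure $\mu$ (that is, $\mu(f_\lambda^{-1}(A))=\mu(A)$ for every Borel set $A\subset\mathbb{C}$) which is absolutely continuous with respect to Lebesgue measure on $\mathbb{C}$,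 but $f_\lambda$ has no invariant Borel probability measure that is absolutely continuous with respect to Lebesgue measure. Moreover, $\lambda=2\pi i$ satisfies (i), (ii) and (iii); in particular $z\mapsto 2\pi i\,e^z$ has a $\sigma$-finite absolutely continuous invariant measure but no absolutely continuous invariant probability measure. -/

import Mathlib

open MeasureTheory Filter Topology

namespace ExpDynamics

/-- The entire map `z ↦ lam * exp z`. -/
noncomputable def expMap (lam : ℂ) (z : ℂ) : ℂ := lam * Complex.exp z

/-- The sequence `F` of complex functions converges to `∞` locally uniformly on the open set `U`,
i.e. uniformly on compact subsets of `U`. -/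
def TendstoInftyLocallyUniformlyOn (F : ℕ → ℂ → ℂ) (U : Set ℂ) : Prop :=
  ∀ K ⊆ U, IsCompact K → ∀ R : ℝ, ∀ᶠ n in atTop, ∀ z ∈ K, R < ‖F n z‖

/-- The iterates of `f` form a normal family on the open set `U`: every sequence of iterates has a
subsequence that converges locally uniformly on `U`, either to a finite function
(holomorphic when `f` is) or to `∞`. -/
def IteratesNormalOn (f : ℂ → ℂ) (U : Set ℂ) : Prop :=
  ∀ n : ℕ → ℕ, ∃ k : ℕ → ℕ, StrictMono k ∧
    ((∃ g : ℂ → ℂ, TendstoLocallyUniformlyOn (fun j => f^[n (k j)]) g atTop U) ∨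
      TendstoInftyLocallyUniformlyOn (fun j => f^[n (k j)]) U)

/-- The Fatou set: the points with a neighbourhood on which the iterates form a normal family. -/
def fatouSet (f : ℂ → ℂ) : Set ℂ :=
  {z | ∃ U : Set ℂ, IsOpen U ∧ z ∈ U ∧ IteratesNormalOn f U}

/-- The Julia set: the complement of the Fatou set in the plane. -/
def juliaSet (f : ℂ → ℂ) : Set ℂ := (fatouSet f)ᶜ

/-- The forward orbit of `z`, including `z` itself. -/
def forwardOrbit (f : ℂ → ℂ) (z : ℂ) : Set ℂ := Set.range fun n : ℕ => f^[n] z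

/-- The `ω`-limit set of `z`, taken in the Riemann sphere `OnePoint ℂ`. -/
def omegaLimitSet (f : ℂ → ℂ) (z : ℂ) : Set (OnePoint ℂ) :=
  omegaLimit atTop (fun (n : ℕ) (w : ℂ) => ((f^[n] w : ℂ) : OnePoint ℂ)) {z}

/-- The post-singular set of `z ↦ lam * exp z` (whose only finite singular value is `0`):
the closure of the orbit of `0`, together with `∞`. -/
def postSingularSet (lam : ℂ) : Set (OnePoint ℂ) :=
  insert OnePoint.infty
    ((fun w : ℂ => (w : OnePoint ℂ)) '' closure (forwardOrbit (expMap lam) 0))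

/-- The standing conditions on the parameter: `lam ≠ 0`, the Julia set is the whole plane, the orbit
of `0` is bounded, and the points whose `ω`-limit set is not contained in the post-singular set
have positive Lebesgue measure. -/
structure Admissible (lam : ℂ) : Prop where
  ne_zero : lam ≠ 0
  julia_eq : juliaSet (expMap lam) = Set.univ
  orbit_bounded : Bornology.IsBounded (forwardOrbit (expMap lam) 0)
  pos_measure : 0 < volume {z : ℂ | ¬ omegaLimitSet (expMap lam) z ⊆ postSingularSet lam}

/-- `μ` is a (nonzero) `f`-invariant measure, absolutely continuous with respect to Lebesgue
measure. -/
structure IsACInvariant (f : ℂ → ℂ) (μ : Measure ℂ) : Prop where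
  ne_zero : μ ≠ 0
  ac : μ ≪ volume
  invariant : MeasurePreserving f μ μ

end ExpDynamics

/-! Let P be `postOrbit`, the finite part of the post-singular set. On a disc that misses P all
inverse branches of all iterates of f exist, with distortion bounded independently of the iterate.
The distortion bound comes from a Bloch-type estimate, which also bounds the derivatives of the
branches themselves, since a branch of the inverse of f^(n+1) cannot take two values differing by
2πi.

Existence: push an integrable density g forward by the transfer operator T and put S_n = g + ... +
T^(n-1) g. The branch estimates give a Harnack inequality for T^n g on discs off P, uniform in n. By
(iii), a set E of positive measure visits some disc B off P infinitely often, so S_n(a) diverges at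
the centre a of B, and liminf S_n / S_n(a), restricted to E, is a density v with Tv ≤ v. Counted
over all visits to B, the defect v - Tv has total mass at most the finite integral of v over B,
although points of E visit B infinitely often; hence Tv = v almost everywhere
(`transfer_ae_eq_of_le`).

Non-existence: the maximum principle and J = ℂ make the complement of P connected
(`isPreconnected_compl_postOrbit`). A density point argument then shows that E has full measure off
P, and a translation by a period that P is null. An absolutely continuous invariant probability
would force S_n(a) to grow linearly, so that the unrestricted limit density is integrable, invariant
and positive off P (`exists_limitDensity_invariant`, `limitDensity_ne_zero`). Harnack and
translation by quarter periods show that its measure ν satisfies ν{Re z < -t} ≥ A/t for large t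
(`exists_le_mul_of_log_le`). But points with Re z < -(Cj + C') land so close to 0 that they shadow
the bounded orbit of 0 and stay away from the far left for j steps. By invariance the masses of such
sets are summable (`sum_measureReal_le`), against the divergence of the harmonic series.

For λ = 2πi, P = {0, 2πi}. The escaping set is null, again by density points, and 2πi is a repelling
fixed point, so almost every orbit accumulates off P. At such points the derivatives of the iterates
blow up along returns, which excludes normality on any open set. -/

namespace ExpDynamics

open Metric Set

/-! ### Distortion of inverse branches -/

/-- A nonvanishing holomorphic function on a disc has a holomorphic logarithm. -/
lemma exists_log_on_ball {g : ℂ → ℂ} {a : ℂ} {R : ℝ} (hg : DifferentiableOn ℂ g (ball a R))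
    (h0 : ∀ x ∈ ball a R, g x ≠ 0) :
    ∃ l : ℂ → ℂ, (∀ x ∈ ball a R, HasDerivAt l (deriv g x / g x) x) ∧
      ∀ x ∈ ball a R, Complex.exp (l x) = g x := by
  rcases (ball a R).eq_empty_or_nonempty with he | hne
  · exact ⟨0, by simp [he], by simp [he]⟩
  have ha : a ∈ ball a R := mem_ball_self (nonempty_ball.1 hne)
  have hd : DifferentiableOn ℂ (fun x => deriv g x / g x) (ball a R) :=
    (hg.deriv isOpen_ball).div hg h0
  obtain ⟨l, hla, hl⟩ := hd.isExactOn_ball.with_val_at a (Complex.log (g a))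
  refine ⟨l, hl, fun x hx => ?_⟩
  have hder : ∀ y ∈ ball a R, HasDerivAt (fun y => g y * Complex.exp (-l y)) 0 y := by
    intro y hy
    have h1 := (hg.differentiableAt (isOpen_ball.mem_nhds hy)).hasDerivAt
    have h2 := h1.mul (hl y hy).neg.cexp
    convert! h2 using 1
    field_simp [h0 y hy]
    ring
  have hc := isOpen_ball.is_const_of_deriv_eq_zero (convex_ball a R).isPreconnected
    (fun y hy => (hder y hy).differentiableAt.differentiableWithinAt)
    (fun y hy => (hder y hy).deriv) hx ha
  simp only [hla, Complex.exp_neg, Complex.exp_log (h0 a ha)] at hc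
  rw [mul_inv_cancel₀ (h0 a ha)] at hc
  field_simp [Complex.exp_ne_zero] at hc
  exact hc.symm

/-- A form of Bloch's theorem: a holomorphic function on a disc whose image is disjoint from its
translate by `2πi` has a bounded derivative at the centre. -/
lemma norm_deriv_mul_le_of_ne_translate {L : ℂ → ℂ} {a : ℂ} {R : ℝ} (hR : 0 < R)
    (hL : DifferentiableOn ℂ L (ball a R))
    (hne : ∀ x ∈ ball a R, ∀ y ∈ ball a R, L x ≠ L y + 2 * Real.pi * Complex.I) :
    ‖deriv L a‖ * R ≤ 2000 := by
  by_contra! hbig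
  have hsub : closedBall a (R / 2) ⊆ ball a R := closedBall_subset_ball (by linarith)
  have hdL : DifferentiableOn ℂ (deriv L) (ball a R) := hL.deriv isOpen_ball
  -- Landau's device: at a maximum `p` of this weighted derivative, `‖deriv L‖` is at most doubled
  -- on the disc of radius `t`, half the distance from `p` to the boundary.
  have hcont : ContinuousOn (fun z => ‖deriv L z‖ * (R / 2 - dist z a)) (closedBall a (R / 2)) :=
    (hdL.continuousOn.mono hsub).norm.mul (by fun_prop)
  obtain ⟨p, hp, hmax⟩ := (isCompact_closedBall a (R / 2)).exists_isMaxOn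
    ⟨a, mem_closedBall_self (by linarith)⟩ hcont
  have hmax' : ∀ z ∈ closedBall a (R / 2),
      ‖deriv L z‖ * (R / 2 - dist z a) ≤ ‖deriv L p‖ * (R / 2 - dist p a) := fun z hz => hmax hz
  set D := ‖deriv L p‖ with hD
  set t := (R / 2 - dist p a) / 2 with ht
  have hDt : 500 < D * t := by
    have := hmax' a (mem_closedBall_self (by linarith))
    simp only [dist_self, sub_zero] at this
    rw [ht]; linarith
  have ht0 : 0 < t := by
    by_contra! h
    have : D * t ≤ 0 := mul_nonpos_of_nonneg_of_nonpos (norm_nonneg _) h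
    linarith
  have hD0 : 0 < D := by
    by_contra! h
    have : D * t ≤ 0 := mul_nonpos_of_nonpos_of_nonneg h ht0.le
    linarith
  have hdist : ∀ z ∈ ball p t, t ≤ R / 2 - dist z a := by
    intro z hz
    have := dist_triangle z p a
    rw [mem_ball] at hz
    rw [ht] at hz ⊢
    linarith
  have hball : ball p t ⊆ closedBall a (R / 2) := fun z hz => by
    rw [mem_closedBall]; linarith [hdist z hz]
  have hbd : ∀ z ∈ ball p t, ‖deriv L z‖ ≤ 2 * D := by
    intro z hz
    have h1 := hmax' z (hball hz)
    have h2 : ‖deriv L z‖ * t ≤ ‖deriv L z‖ * (R / 2 - dist z a) :=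
      mul_le_mul_of_nonneg_left (hdist z hz) (norm_nonneg _)
    have h3 : ‖deriv L z‖ * t ≤ (2 * D) * t := by
      have : D * (R / 2 - dist p a) = (2 * D) * t := by rw [ht]; ring
      linarith
    exact le_of_mul_le_mul_right h3 ht0
  -- Schwarz lemma for `deriv L - deriv L p`, which is bounded by 3D on the disc of radius `t`. On
  -- radius t/6, `L` is then close to an affine map.
  have hschw : ∀ z ∈ closedBall p (t / 6), ‖deriv L z - deriv L p‖ ≤ D / 2 := by
    intro z hz
    rw [mem_closedBall] at hz
    have h1 : MapsTo (deriv L) (ball p t) (closedBall (deriv L p) (3 * D)) := by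
      intro w hw
      rw [mem_closedBall, dist_eq_norm]
      have := norm_sub_le (deriv L w) (deriv L p)
      linarith [hbd w hw]
    have h2 := Complex.dist_le_div_mul_dist_of_mapsTo_ball (hdL.mono (hball.trans hsub)) h1
      (show z ∈ ball p t by rw [mem_ball]; linarith)
    rw [dist_eq_norm] at h2
    calc _ ≤ 3 * D / t * dist z p := h2
      _ ≤ 3 * D / t * (t / 6) := by gcongr
      _ = D / 2 := by field_simp; ring
  have hsub6 : closedBall p (t / 6) ⊆ ball a R :=
    ((closedBall_subset_ball (by linarith)).trans hball).trans hsub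
  have hlow : ∀ z ∈ sphere p (t / 6), D * t / 12 ≤ ‖L z - L p‖ := by
    intro z hz
    have hz' : z ∈ closedBall p (t / 6) := sphere_subset_closedBall hz
    have hmv := (convex_closedBall p (t / 6)).norm_image_sub_le_of_norm_hasDerivWithin_le
      (f := fun w => L w - deriv L p * w) (f' := fun w => deriv L w - deriv L p) (C := D / 2)
      (fun w hw => by
        have h1 := (hL.differentiableAt (isOpen_ball.mem_nhds (hsub6 hw))).hasDerivAt
        have h2 := h1.sub ((hasDerivAt_id w).const_mul (deriv L p))
        simp only [id, mul_one] at h2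
        exact h2.hasDerivWithinAt)
      hschw (mem_closedBall_self (by positivity)) hz'
    have hzp : ‖z - p‖ = t / 6 := by rwa [mem_sphere, dist_eq_norm] at hz
    have h3 : ‖deriv L p * (z - p)‖ = D * (t / 6) := by rw [norm_mul, hzp]
    have h4 : deriv L p * (z - p) =
        (L z - L p) - (L z - deriv L p * z - (L p - deriv L p * p)) := by ring
    have h5 := norm_sub_le (L z - L p) (L z - deriv L p * z - (L p - deriv L p * p))
    rw [← h4, h3] at h5
    rw [hzp] at hmv
    linarith
  -- The covered disc has radius Dt/24 > 500/24 > 2π, so it contains the translate of `L p`.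
  have himg := DiffContOnCl.ball_subset_image_closedBall
    (DifferentiableOn.diffContOnCl_ball (hL.mono hsub6) subset_rfl) (by positivity) hlow (by
      have h1 := (hL.differentiableAt (isOpen_ball.mem_nhds (hsub hp))).hasDerivAt
      exact (h1.eventually_ne (c := L p) (norm_pos_iff.1 hD0)).frequently.filter_mono
        nhdsWithin_le_nhds)
  obtain ⟨x, hx, hxe⟩ := himg (show L p + 2 * Real.pi * Complex.I ∈ ball (L p) (D * t / 12 / 2) by
    rw [mem_ball, dist_eq_norm, add_sub_cancel_left]
    have : ‖(2 * Real.pi * Complex.I : ℂ)‖ = 2 * Real.pi := by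
      simp [abs_of_pos Real.pi_pos]
    rw [this]
    linarith [Real.pi_lt_d2])
  exact hne x (hsub6 hx) p (hsub hp) hxe

/-- A weak form of Koebe's covering theorem. -/
lemma ball_subset_image_ball_of_injOn {φ : ℂ → ℂ} {a : ℂ} {R : ℝ} (hR : 0 < R)
    (hφ : DifferentiableOn ℂ φ (ball a R)) (hinj : InjOn φ (ball a R)) :
    ball (φ a) (‖deriv φ a‖ * R / 2000) ⊆ φ '' ball a R := by
  intro w hw
  by_contra hn
  have h0 : ∀ x ∈ ball a R, φ x - w ≠ 0 := fun x hx h => hn ⟨x, hx, sub_eq_zero.1 h⟩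
  -- If `w` is omitted, log(φ - w) exists, and injectivity of φ makes its image disjoint from its
  -- translate by 2πi.
  obtain ⟨l, hl, hle⟩ := exists_log_on_ball (hφ.sub_const w) h0
  have ha : a ∈ ball a R := mem_ball_self hR
  have hB := norm_deriv_mul_le_of_ne_translate hR
    (fun x hx => (hl x hx).differentiableAt.differentiableWithinAt) (fun x hx y hy h => by
      have he : Complex.exp (l x) = Complex.exp (l y) := by
        rw [h, Complex.exp_add, Complex.exp_two_pi_mul_I, mul_one]
      rw [hle x hx, hle y hy, sub_left_inj] at he
      obtain rfl := hinj hx hy he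
      have : (2 * Real.pi * Complex.I : ℂ) = 0 := by linear_combination -h
      simp [Real.pi_ne_zero] at this)
  rw [(hl a ha).deriv, deriv_sub_const, norm_div, div_mul_eq_mul_div, div_le_iff₀
    (norm_pos_iff.2 (h0 a ha))] at hB
  rw [mem_ball, dist_comm, dist_eq_norm] at hw
  linarith

/-- `φ` is a holomorphic inverse branch of `F` on the disc `ball a R`. -/
structure IsInverseBranch (F φ : ℂ → ℂ) (a : ℂ) (R : ℝ) : Prop where
  diff : DifferentiableOn ℂ φ (ball a R)
  right_inv : ∀ x ∈ ball a R, F (φ x) = x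

namespace IsInverseBranch

variable {F φ : ℂ → ℂ} {a : ℂ} {R : ℝ}

lemma mono (h : IsInverseBranch F φ a R) {b : ℂ} {S : ℝ} (hs : ball b S ⊆ ball a R) :
    IsInverseBranch F φ b S :=
  ⟨h.diff.mono hs, fun x hx => h.right_inv x (hs hx)⟩

lemma injOn (h : IsInverseBranch F φ a R) : InjOn φ (ball a R) := fun x hx y hy hxy => by
  rw [← h.right_inv x hx, ← h.right_inv y hy, hxy]

lemma hasDerivAt (h : IsInverseBranch F φ a R) {x : ℂ} (hx : x ∈ ball a R) :
    HasDerivAt φ (deriv φ x) x :=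
  (h.diff.differentiableAt (isOpen_ball.mem_nhds hx)).hasDerivAt

lemma deriv_mul (h : IsInverseBranch F φ a R) (hF : Differentiable ℂ F) {x : ℂ}
    (hx : x ∈ ball a R) : deriv F (φ x) * deriv φ x = 1 := by
  have h1 : HasDerivAt (F ∘ φ) (deriv F (φ x) * deriv φ x) x :=
    (hF (φ x)).hasDerivAt.comp x (h.hasDerivAt hx)
  have h2 : HasDerivAt (F ∘ φ) 1 x :=
    (hasDerivAt_id x).congr_of_eventuallyEq (by
      filter_upwards [isOpen_ball.mem_nhds hx] with y hy using h.right_inv y hy)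
  exact h1.unique h2

lemma deriv_ne_zero (h : IsInverseBranch F φ a R) (hF : Differentiable ℂ F) {x : ℂ}
    (hx : x ∈ ball a R) : deriv φ x ≠ 0 :=
  right_ne_zero_of_mul (by rw [h.deriv_mul hF hx]; exact one_ne_zero)

lemma norm_deriv_mul (h : IsInverseBranch F φ a R) (hF : Differentiable ℂ F) {x : ℂ}
    (hx : x ∈ ball a R) : ‖deriv F (φ x)‖ * ‖deriv φ x‖ = 1 := by
  rw [← norm_mul, h.deriv_mul hF hx, norm_one]

/-- The image of an inverse branch omits a value which is not far from the image of the centre. -/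
lemma exists_omitted (h : IsInverseBranch F φ a R) (hF : Differentiable ℂ F) (hR : 0 < R) :
    ∃ w, (∀ x ∈ ball a R, φ x ≠ w) ∧ ‖φ a - w‖ ≤ 2 * R * ‖deriv φ a‖ := by
  by_contra! hcon
  have ha : a ∈ ball a R := mem_ball_self hR
  have hd : 0 < ‖deriv φ a‖ := norm_pos_iff.2 (h.deriv_ne_zero hF ha)
  -- With no omitted value nearby, F would map this disc into one of radius R, and Cauchy's estimate
  -- would give |F'||φ'| ≤ 1/2 where the product is 1.
  have hmaps : MapsTo F (ball (φ a) (2 * R * ‖deriv φ a‖)) (closedBall (F (φ a)) R) := by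
    intro w hw
    by_contra hn
    have : ∀ x ∈ ball a R, φ x ≠ w := by
      rintro x hx rfl
      rw [h.right_inv x hx, h.right_inv a ha] at hn
      exact hn (ball_subset_closedBall hx)
    have h1 := hcon w this
    rw [mem_ball, dist_comm, dist_eq_norm] at hw
    linarith
  have hs := Complex.norm_deriv_le_div_of_mapsTo_ball hF.differentiableOn hmaps (by positivity)
  have h1 := h.norm_deriv_mul hF ha
  rw [le_div_iff₀ (by positivity)] at hs
  nlinarith

/-- Growth of an inverse branch on a small concentric disc. -/
lemma norm_sub_le (h : IsInverseBranch F φ a R) (hF : Differentiable ℂ F) (hR : 0 < R) {z : ℂ}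
    (hz : z ∈ closedBall a (R / 40000)) : ‖φ z - φ a‖ ≤ 52 * R * ‖deriv φ a‖ := by
  have ha : a ∈ ball a R := mem_ball_self hR
  obtain ⟨w, hw, hwd⟩ := h.exists_omitted hF hR
  have h0 : ∀ x ∈ ball a R, φ x - w ≠ 0 := fun x hx => sub_ne_zero.2 (hw x hx)
  obtain ⟨l, hl, hle⟩ := exists_log_on_ball (h.diff.sub_const w) h0
  -- A square root of φ - w. As φ is injective, the images of `s` and `-s` are disjoint; `s` covers
  -- a disc about `s a`, so its values stay away from `-s a`.
  set s : ℂ → ℂ := fun x => Complex.exp (l x / 2) with hs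
  have hsd : ∀ x ∈ ball a R, HasDerivAt s (s x * (deriv φ x / (φ x - w) / 2)) x := by
    intro x hx
    have := ((hl x hx).div_const 2).cexp
    rwa [deriv_sub_const] at this
  have hsq : ∀ x ∈ ball a R, s x ^ 2 = φ x - w := by
    intro x hx
    rw [← hle x hx, hs, ← Complex.exp_nat_mul]
    congr 1
    push_cast
    ring
  have hs0 : ∀ x, s x ≠ 0 := fun x => Complex.exp_ne_zero _
  have hsqinj : ∀ x ∈ ball a R, ∀ y ∈ ball a R, s x ^ 2 = s y ^ 2 → x = y := by
    intro x hx y hy hxy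
    rw [hsq x hx, hsq y hy, sub_left_inj] at hxy
    exact h.injOn hx hy hxy
  have hsdiff : DifferentiableOn ℂ s (ball a R) :=
    fun x hx => (hsd x hx).differentiableAt.differentiableWithinAt
  have hsa : 0 < ‖s a‖ := norm_pos_iff.2 (hs0 a)
  have hda : ‖s a‖ / (4 * R) ≤ ‖deriv s a‖ := by
    rw [(hsd a ha).deriv, norm_mul, norm_div, norm_div, Complex.norm_ofNat, div_eq_mul_one_div]
    refine mul_le_mul_of_nonneg_left ?_ hsa.le
    have hpos : 0 < ‖φ a - w‖ := norm_pos_iff.2 (h0 a ha)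
    rw [div_div, div_le_div_iff₀ (by positivity) (by positivity)]
    linarith
  have hcov : ball (s a) (‖s a‖ / 8000) ⊆ s '' ball a R := by
    refine (ball_subset_ball ?_).trans (ball_subset_image_ball_of_injOn hR hsdiff
      (fun x hx y hy hxy => hsqinj x hx y hy (by rw [hxy])))
    have := mul_le_mul_of_nonneg_right hda hR.le
    have h2 : ‖s a‖ / (4 * R) * R = ‖s a‖ / 4 := by field_simp
    linarith
  have hfar : ∀ x ∈ ball a R, ‖s a‖ / 8000 ≤ ‖s x + s a‖ := by
    intro x hx
    by_contra! hlt
    obtain ⟨y, hy, hye⟩ := hcov (show -s x ∈ ball (s a) (‖s a‖ / 8000) by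
      rw [mem_ball, dist_comm, dist_eq_norm, sub_neg_eq_add, add_comm]; exact hlt)
    obtain rfl := hsqinj y hy x hx (by rw [hye]; ring)
    have : s y = 0 := by linear_combination hye / 2
    exact hs0 y this
  have hne : ∀ x ∈ ball a R, s x + s a ≠ 0 := fun x hx =>
    norm_pos_iff.1 (lt_of_lt_of_le (by positivity) (hfar x hx))
  -- Bounded by the previous step and equal to 1/2 at `a`, so by Schwarz it stays away from 0 near
  -- `a`, which bounds `s` from above.
  set G : ℂ → ℂ := fun x => s a / (s x + s a) with hG
  have hGd : DifferentiableOn ℂ G (ball a R) :=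
    (differentiableOn_const _).div (hsdiff.add_const _) hne
  have hGa : G a = 1 / 2 := by
    simp only [hG]; rw [← two_mul, mul_comm, div_mul_eq_div_div, div_self (hs0 a)]
  have hGmaps : MapsTo G (ball a R) (closedBall (G a) 8001) := by
    intro x hx
    rw [mem_closedBall, dist_eq_norm, hGa]
    have h1 : ‖G x‖ ≤ 8000 := by
      simp only [hG]
      rw [norm_div, div_le_iff₀ (norm_pos_iff.2 (hne x hx))]
      linarith [hfar x hx]
    have h2 := _root_.norm_sub_le (G x) (1 / 2)
    have h3 : ‖(1 / 2 : ℂ)‖ = 1 / 2 := by norm_num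
    linarith
  rw [mem_closedBall] at hz
  have hzR : z ∈ ball a R := by rw [mem_ball]; linarith
  have hGz := Complex.dist_le_div_mul_dist_of_mapsTo_ball hGd hGmaps hzR
  have hGz' : ‖G z - 1 / 2‖ ≤ 1 / 4 := by
    rw [hGa, dist_eq_norm] at hGz
    refine hGz.trans ?_
    calc 8001 / R * dist z a ≤ 8001 / R * (R / 40000) := by gcongr
      _ = 8001 / 40000 := by field_simp
      _ ≤ 1 / 4 := by norm_num
  have hGlow : 1 / 4 ≤ ‖G z‖ := by
    have h3 : ‖(1 / 2 : ℂ)‖ = 1 / 2 := by norm_num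
    have := norm_sub_norm_le (1 / 2 : ℂ) (1 / 2 - G z)
    rw [sub_sub_cancel, norm_sub_rev (1 / 2 : ℂ)] at this
    linarith
  have hsz : ‖s z‖ ≤ 5 * ‖s a‖ := by
    have h1 : ‖s z + s a‖ ≤ 4 * ‖s a‖ := by
      simp only [hG] at hGlow
      rw [norm_div, le_div_iff₀ (norm_pos_iff.2 (hne z hzR))] at hGlow
      linarith
    have h2 := _root_.norm_sub_le (s z + s a) (s a)
    rw [add_sub_cancel_right] at h2
    linarith
  have hφz : ‖φ z - w‖ ≤ 25 * ‖φ a - w‖ := by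
    rw [← hsq z hzR, ← hsq a ha, norm_pow, norm_pow]
    have := pow_le_pow_left₀ (norm_nonneg _) hsz 2
    linarith
  have h5 := _root_.norm_sub_le (φ z - w) (φ a - w)
  rw [sub_sub_sub_cancel_right] at h5
  linarith

/-- Cauchy's estimate used twice, on circles of radius R/80000, so that both stay within the disc of
the growth bound. -/
lemma norm_deriv_deriv_le (h : IsInverseBranch F φ a R) (hF : Differentiable ℂ F) (hR : 0 < R) :
    ‖deriv (deriv φ) a‖ ≤ 4 * 10 ^ 11 / R * ‖deriv φ a‖ := by
  set r : ℝ := R / 80000 with hr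
  have hr0 : 0 < r := by positivity
  have hsub : closedBall a r ⊆ ball a R := closedBall_subset_ball (by rw [hr]; linarith)
  have h1 : ∀ z ∈ closedBall a r, ‖deriv φ z‖ ≤ 52 * R * ‖deriv φ a‖ / r := by
    intro z hz
    have hzz : closedBall z r ⊆ closedBall a (R / 40000) :=
      closedBall_subset_closedBall' (by rw [mem_closedBall] at hz; rw [hr] at *; linarith)
    have hzR : closedBall z r ⊆ ball a R := hzz.trans (closedBall_subset_ball (by linarith))
    have := Complex.norm_deriv_le_of_forall_mem_sphere_norm_le hr0
      (((h.diff.sub_const (φ a)).mono hzR).diffContOnCl_ball subset_rfl)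
      (fun x hx => h.norm_sub_le hF hR (hzz (sphere_subset_closedBall hx)))
    rwa [deriv_sub_const] at this
  have h2 := Complex.norm_deriv_le_of_forall_mem_sphere_norm_le hr0
      (((h.diff.deriv isOpen_ball).mono hsub).diffContOnCl_ball subset_rfl)
      (fun x hx => h1 x (sphere_subset_closedBall hx))
  refine h2.trans ?_
  have : 52 * R * ‖deriv φ a‖ / r / r = 52 * 80000 ^ 2 / R * ‖deriv φ a‖ := by
    rw [hr]; field_simp
  have hnum : (52 * 80000 ^ 2 : ℝ) ≤ 4 * 10 ^ 11 := by norm_num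
  rw [this]
  exact mul_le_mul_of_nonneg_right (div_le_div_of_nonneg_right hnum hR.le) (norm_nonneg _)

end IsInverseBranch

/-- The constant in the distortion theorem for inverse branches of entire functions. -/
noncomputable def distortionConst : ℝ := Real.exp (8 * 10 ^ 11)

lemma distortionConst_pos : 0 < distortionConst := Real.exp_pos _

/-- A weak form of Koebe's distortion theorem. -/
lemma IsInverseBranch.norm_deriv_le {F φ : ℂ → ℂ} {a : ℂ} {R : ℝ} (h : IsInverseBranch F φ a R)
    (hF : Differentiable ℂ F) {x y : ℂ} (hx : x ∈ ball a (R / 2)) (hy : y ∈ ball a (R / 2)) :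
    ‖deriv φ x‖ ≤ distortionConst * ‖deriv φ y‖ := by
  have hR : 0 < R := by linarith [nonempty_ball.1 ⟨x, hx⟩]
  have hsub : ball a (R / 2) ⊆ ball a R := ball_subset_ball (by linarith)
  have h0 : ∀ x ∈ ball a (R / 2), deriv φ x ≠ 0 := fun x hx => h.deriv_ne_zero hF (hsub hx)
  obtain ⟨l, hl, hle⟩ := exists_log_on_ball ((h.diff.deriv isOpen_ball).mono hsub) h0
  -- This quotient is the derivative of log φ'. Each `z` is the centre of a disc of radius R/2
  -- inside the given one; integrating over a length at most R bounds the variation of log φ'.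
  have hbd : ∀ z ∈ ball a (R / 2), ‖deriv (deriv φ) z / deriv φ z‖ ≤ 8 * 10 ^ 11 / R := by
    intro z hz
    rw [norm_div, div_le_iff₀ (norm_pos_iff.2 (h0 z hz))]
    have hz' : IsInverseBranch F φ z (R / 2) := h.mono
      (ball_subset_ball' (by rw [mem_ball] at hz; linarith))
    refine (hz'.norm_deriv_deriv_le hF (by positivity)).trans_eq ?_
    field_simp
    ring
  have hmv := (convex_ball a (R / 2)).norm_image_sub_le_of_norm_hasDerivWithin_le
    (fun z hz => (hl z hz).hasDerivWithinAt) hbd hy hx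
  have hxy : ‖x - y‖ ≤ R := by
    rw [← dist_eq_norm]
    have := dist_triangle_right x y a
    rw [mem_ball] at hx hy
    linarith
  have h1 : ‖l x - l y‖ ≤ 8 * 10 ^ 11 := by
    refine hmv.trans ?_
    calc _ ≤ 8 * 10 ^ 11 / R * R := by gcongr
      _ = _ := by field_simp
  have h2 : (l x).re ≤ 8 * 10 ^ 11 + (l y).re := by
    have := (Complex.re_le_norm (l x - l y)).trans h1
    rw [Complex.sub_re] at this
    linarith
  rw [← hle x hx, ← hle y hy, Complex.norm_exp, Complex.norm_exp, distortionConst, ← Real.exp_add]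
  exact Real.exp_le_exp.2 h2

/-! ### Change of variables for holomorphic maps -/

lemma det_restrictScalars_smulRight (c : ℂ) :
    (((1 : ℂ →L[ℂ] ℂ).smulRight c).restrictScalars ℝ).det = ‖c‖ ^ 2 := by
  rw [← Complex.normSq_eq_norm_sq, ← Algebra.norm_complex_apply, Algebra.norm_apply]
  simp only [ContinuousLinearMap.det]
  congr 1
  ext
  simp [mul_comm]

lemma lintegral_image_of_hasDerivAt {φ φ' : ℂ → ℂ} {s : Set ℂ} (hs : MeasurableSet s)
    (hd : ∀ x ∈ s, HasDerivAt φ (φ' x) x) (hinj : InjOn φ s) (g : ℂ → ENNReal) :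
    ∫⁻ x in φ '' s, g x = ∫⁻ x in s, ENNReal.ofReal (‖φ' x‖ ^ 2) * g (φ x) := by
  have := lintegral_image_eq_lintegral_abs_det_fderiv_mul volume hs
    (fun x hx => ((hd x hx).hasFDerivAt.restrictScalars ℝ).hasFDerivWithinAt) hinj g
  rw [this]
  refine lintegral_congr fun x => ?_
  congr 2
  rw [← abs_of_nonneg (sq_nonneg ‖φ' x‖)]
  congr 1
  erw [← det_restrictScalars_smulRight]
  rfl

/-! ### Elementary properties of the exponential family -/

variable {lam : ℂ}

lemma hasDerivAt_expMap (lam z : ℂ) : HasDerivAt (expMap lam) (expMap lam z) z :=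
  (Complex.hasDerivAt_exp z).const_mul lam

lemma differentiable_expMap (lam : ℂ) : Differentiable ℂ (expMap lam) :=
  fun z => (hasDerivAt_expMap lam z).differentiableAt

lemma differentiable_iterate (lam : ℂ) (n : ℕ) : Differentiable ℂ (expMap lam)^[n] :=
  (differentiable_expMap lam).iterate n

lemma measurable_expMap (lam : ℂ) : Measurable (expMap lam) :=
  (differentiable_expMap lam).continuous.measurable

lemma measurable_iterate (lam : ℂ) (n : ℕ) : Measurable (expMap lam)^[n] :=
  (differentiable_iterate lam n).continuous.measurable

lemma expMap_ne_zero (hlam : lam ≠ 0) (z : ℂ) : expMap lam z ≠ 0 :=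
  mul_ne_zero hlam (Complex.exp_ne_zero z)

lemma norm_expMap (lam z : ℂ) : ‖expMap lam z‖ = ‖lam‖ * Real.exp z.re := by
  rw [expMap, norm_mul, Complex.norm_exp]

lemma expMap_eq_iff (hlam : lam ≠ 0) {z w : ℂ} :
    expMap lam z = expMap lam w ↔ ∃ k : ℤ, z = w + k * (2 * Real.pi * Complex.I) := by
  rw [expMap, expMap, mul_right_inj' hlam, Complex.exp_eq_exp_iff_exists_int]

lemma expMap_add_int_mul (lam z : ℂ) (k : ℤ) :
    expMap lam (z + k * (2 * Real.pi * Complex.I)) = expMap lam z := by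
  rw [expMap, expMap, Complex.exp_eq_exp_iff_exists_int.2 ⟨k, rfl⟩]

lemma deriv_iterate_succ (lam : ℂ) (n : ℕ) (z : ℂ) :
    deriv (expMap lam)^[n + 1] z = expMap lam ((expMap lam)^[n] z) * deriv (expMap lam)^[n] z := by
  rw [Function.iterate_succ']
  exact ((hasDerivAt_expMap lam _).comp z (differentiable_iterate lam n z).hasDerivAt).deriv

/-- The finite part of the post-singular set. -/
def postOrbit (lam : ℂ) : Set ℂ := closure (forwardOrbit (expMap lam) 0)

lemma isClosed_postOrbit (lam : ℂ) : IsClosed (postOrbit lam) := isClosed_closure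

lemma iterate_zero_mem_postOrbit (lam : ℂ) (n : ℕ) : (expMap lam)^[n] 0 ∈ postOrbit lam :=
  subset_closure ⟨n, rfl⟩

lemma expMap_mem_postOrbit {z : ℂ} (hz : z ∈ postOrbit lam) : expMap lam z ∈ postOrbit lam := by
  have hc := (differentiable_expMap lam).continuous
  have : MapsTo (expMap lam) (forwardOrbit (expMap lam) 0) (forwardOrbit (expMap lam) 0) := by
    rintro _ ⟨n, rfl⟩
    exact ⟨n + 1, Function.iterate_succ_apply' _ _ _⟩
  exact this.closure hc hz

lemma iterate_mem_postOrbit {z : ℂ} (hz : z ∈ postOrbit lam) (n : ℕ) :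
    (expMap lam)^[n] z ∈ postOrbit lam := by
  induction n with
  | zero => exact hz
  | succ n ih => rw [Function.iterate_succ_apply']; exact expMap_mem_postOrbit ih

/-! ### The transfer operator -/

/-- The branches of the inverse of `expMap lam`. -/
noncomputable def logBranch (lam : ℂ) (k : ℤ) (x : ℂ) : ℂ :=
  Complex.log (x / lam) + k * (2 * Real.pi * Complex.I)

/-- The transfer operator of `expMap lam` with respect to Lebesgue measure. -/
noncomputable def transfer (lam : ℂ) (g : ℂ → ENNReal) (x : ℂ) : ENNReal :=
  ∑' k : ℤ, g (logBranch lam k x) * ENNReal.ofReal ((‖x‖ ^ 2)⁻¹)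

lemma measurable_logBranch (lam : ℂ) (k : ℤ) : Measurable (logBranch lam k) :=
  (Complex.measurable_log.comp (measurable_id.div_const lam)).add_const _

lemma expMap_logBranch (hlam : lam ≠ 0) (k : ℤ) {x : ℂ} (hx : x ≠ 0) :
    expMap lam (logBranch lam k x) = x := by
  rw [logBranch, expMap_add_int_mul, expMap, Complex.exp_log (div_ne_zero hx hlam),
    mul_div_cancel₀ _ hlam]

lemma exists_logBranch_eq (hlam : lam ≠ 0) (z : ℂ) :
    ∃ k, logBranch lam k (expMap lam z) = z := by
  obtain ⟨k, hk⟩ := (expMap_eq_iff hlam).1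
    (expMap_logBranch hlam 0 (expMap_ne_zero hlam z)).symm
  refine ⟨k, ?_⟩
  simp only [logBranch, Int.cast_zero, zero_mul, add_zero] at hk ⊢
  exact hk.symm

lemma logBranch_injective (lam x : ℂ) : Function.Injective fun k => logBranch lam k x := by
  intro k l h
  simpa [logBranch, Real.pi_ne_zero] using h

lemma measurable_transfer {g : ℂ → ENNReal} (hg : Measurable g) :
    Measurable (transfer lam g) :=
  Measurable.tsum fun k => (hg.comp (measurable_logBranch lam k)).mul (by fun_prop)

lemma measurable_transfer_iterate {g : ℂ → ENNReal} (hg : Measurable g) (n : ℕ) :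
    Measurable ((transfer lam)^[n] g) := by
  induction n with
  | zero => exact hg
  | succ n ih => rw [Function.iterate_succ_apply']; exact measurable_transfer ih

lemma transfer_add (g h : ℂ → ENNReal) :
    transfer lam (g + h) = transfer lam g + transfer lam h := by
  ext x
  simp only [transfer, Pi.add_apply, add_mul, ENNReal.tsum_add]

lemma transfer_zero : transfer lam 0 = 0 := by
  ext x
  simp [transfer]

lemma transfer_sum {ι : Type*} (s : Finset ι) (g : ι → ℂ → ENNReal) :
    transfer lam (∑ i ∈ s, g i) = ∑ i ∈ s, transfer lam (g i) := by
  classical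
  induction s using Finset.induction_on with
  | empty => simp [transfer_zero]
  | insert i s hi ih => rw [Finset.sum_insert hi, Finset.sum_insert hi, transfer_add, ih]

lemma transfer_mul_const (g : ℂ → ENNReal) (c : ENNReal) (x : ℂ) :
    transfer lam (fun z => g z * c) x = transfer lam g x * c := by
  simp only [transfer, ← ENNReal.tsum_mul_right]
  exact tsum_congr fun k => by ring

lemma transfer_indicator (hlam : lam ≠ 0) {E : Set ℂ} (hE : expMap lam ⁻¹' E = E)
    (g : ℂ → ENNReal) : transfer lam (E.indicator g) = E.indicator (transfer lam g) := by
  ext x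
  -- The point 0 has no preimage; there the weight is `0⁻¹ = 0`, so both sides vanish.
  rcases eq_or_ne x 0 with rfl | hx
  · simp [transfer, indicator]
  have hmem : ∀ k, logBranch lam k x ∈ E ↔ x ∈ E := fun k => by
    rw [← hE, mem_preimage, expMap_logBranch hlam k hx, hE]
  by_cases hxE : x ∈ E
  · simp [transfer, hmem, hxE]
  · simp [transfer, hmem, hxE]

/-- The transfer operator is dual to composition with `expMap lam`. -/
lemma setLIntegral_preimage (hlam : lam ≠ 0) {A : Set ℂ} (hA : MeasurableSet A)
    {g : ℂ → ENNReal} (hg : Measurable g) :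
    ∫⁻ z in expMap lam ⁻¹' A, g z = ∫⁻ x in A, transfer lam g x := by
  have hf := measurable_expMap lam
  -- The strips on which the k-th branch inverts the map: they partition the preimage, and each is
  -- mapped bijectively onto `A \ {0}`.
  set S : ℤ → Set ℂ := fun k => {z | logBranch lam k (expMap lam z) = z} ∩ expMap lam ⁻¹' A with hS
  have hSm : ∀ k, MeasurableSet (S k) := fun k =>
    (measurableSet_eq_fun ((measurable_logBranch lam k).comp hf) measurable_id).inter (hf hA)
  have hU : expMap lam ⁻¹' A = ⋃ k, S k := by
    ext z
    simp only [hS, mem_iUnion, mem_inter_iff, mem_ofPred_eq, exists_and_right]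
    exact ⟨fun h => ⟨exists_logBranch_eq hlam z, h⟩, fun h => h.2⟩
  have hdisj : Pairwise (Function.onFun Disjoint S) := by
    intro k l hkl
    refine Set.disjoint_left.2 fun z hz hz' => hkl (logBranch_injective lam (expMap lam z) ?_)
    exact hz.1.trans hz'.1.symm
  rw [hU, lintegral_iUnion hSm hdisj]
  simp only [transfer]
  rw [lintegral_tsum (f := fun k x => g (logBranch lam k x) * ENNReal.ofReal ((‖x‖ ^ 2)⁻¹))
    fun k => ((hg.comp (measurable_logBranch lam k)).mul (by fun_prop)).aemeasurable]
  refine tsum_congr fun k => ?_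
  have himg : expMap lam '' S k = A \ {0} := by
    ext x
    constructor
    · rintro ⟨z, hz, rfl⟩
      exact ⟨hz.2, expMap_ne_zero hlam z⟩
    · rintro ⟨hxA, hx⟩
      have hx0 : x ≠ 0 := hx
      refine ⟨logBranch lam k x, ⟨?_, ?_⟩, expMap_logBranch hlam k hx0⟩
      · rw [mem_ofPred_eq, expMap_logBranch hlam k hx0]
      · rw [mem_preimage, expMap_logBranch hlam k hx0]; exact hxA
  have hae : (A \ {0} : Set ℂ) =ᵐ[volume] A :=
    sdiff_null_ae_eq_self (measure_singleton 0)
  rw [← setLIntegral_congr hae, ← himg, lintegral_image_of_hasDerivAt (hSm k)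
    (fun x _ => hasDerivAt_expMap lam x)
    (fun x hx y hy h => by rw [← hx.1, ← hy.1, h])]
  refine setLIntegral_congr_fun (hSm k) fun z hz => ?_
  have h0 : 0 < ‖expMap lam z‖ ^ 2 := by
    have := norm_pos_iff.2 (expMap_ne_zero hlam z)
    positivity
  have hz1 : logBranch lam k (expMap lam z) = z := hz.1
  simp only [hz1]
  rw [mul_comm, mul_assoc, ← ENNReal.ofReal_mul (by positivity), inv_mul_cancel₀ h0.ne',
    ENNReal.ofReal_one, mul_one]

lemma setLIntegral_preimage_iterate (hlam : lam ≠ 0) {A : Set ℂ} (hA : MeasurableSet A)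
    {g : ℂ → ENNReal} (hg : Measurable g) (n : ℕ) :
    ∫⁻ z in (expMap lam)^[n] ⁻¹' A, g z = ∫⁻ x in A, (transfer lam)^[n] g x := by
  induction n generalizing g with
  | zero => rfl
  | succ n ih =>
    rw [Function.iterate_succ_apply, ← ih (measurable_transfer hg),
      ← setLIntegral_preimage hlam (measurable_iterate lam n hA) hg]
    rw [← preimage_comp, ← Function.iterate_succ]

lemma lintegral_transfer_iterate (hlam : lam ≠ 0) {g : ℂ → ENNReal} (hg : Measurable g) (n : ℕ) :
    ∫⁻ x, (transfer lam)^[n] g x = ∫⁻ z, g z := by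
  have := setLIntegral_preimage_iterate hlam MeasurableSet.univ hg n
  simpa using this.symm

lemma volume_preimage_iterate_eq_zero (hlam : lam ≠ 0) {A : Set ℂ} (hA : MeasurableSet A)
    (h0 : volume A = 0) (n : ℕ) : volume ((expMap lam)^[n] ⁻¹' A) = 0 := by
  have := setLIntegral_preimage_iterate hlam hA (measurable_const (a := (1 : ENNReal))) n
  rw [setLIntegral_measure_zero _ _ h0, setLIntegral_one] at this
  exact this

/-! ### Inverse branches of iterates -/

/-- On a disc disjoint from the post-singular set all inverse branches of the iterates exist, and
they describe the iterates of the transfer operator. -/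
lemma exists_inverseBranches (hlam : lam ≠ 0) {a : ℂ} {R : ℝ}
    (hd : Disjoint (ball a R) (postOrbit lam)) (n : ℕ) :
    ∃ (ι : Type) (φ : ι → ℂ → ℂ), (∀ i, IsInverseBranch (expMap lam)^[n] (φ i) a R) ∧
      (∀ x ∈ ball a R, ∀ w, (expMap lam)^[n] w = x → ∃ i, φ i x = w) ∧
      ∀ x ∈ ball a R, ∀ g : ℂ → ENNReal, (transfer lam)^[n] g x =
        ∑' i, g (φ i x) * ENNReal.ofReal (‖deriv (φ i) x‖ ^ 2) := by
  induction n with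
  | zero =>
    refine ⟨Unit, fun _ => id, fun _ => ⟨differentiableOn_id, fun x _ => rfl⟩,
      fun x _ w hw => ⟨(), hw.symm⟩, fun x _ g => by simp⟩
  | succ n ih =>
    obtain ⟨ι, φ, hφ, hsurj, hT⟩ := ih
    -- A zero of φ would put an iterate of 0 into the disc. Hence log(φ/λ) exists, and its
    -- translates by 2πiℤ are the branches of the next iterate.
    have hne : ∀ i, ∀ x ∈ ball a R, φ i x ≠ 0 := by
      intro i x hx h0
      have h1 := (hφ i).right_inv x hx
      rw [h0] at h1
      exact Set.disjoint_left.1 hd hx (h1 ▸ iterate_zero_mem_postOrbit lam n)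
    have hlog : ∀ i, ∃ l : ℂ → ℂ, (∀ x ∈ ball a R, HasDerivAt l (deriv (φ i) x / φ i x) x) ∧
        ∀ x ∈ ball a R, expMap lam (l x) = φ i x := by
      intro i
      obtain ⟨l, hl, hle⟩ := exists_log_on_ball ((hφ i).diff.div_const lam)
        (fun x hx => div_ne_zero (hne i x hx) hlam)
      refine ⟨l, fun x hx => ?_, fun x hx => ?_⟩
      · convert! hl x hx using 1
        rw [deriv_div_const, div_div_div_cancel_right₀ hlam]
      · rw [expMap, hle x hx, mul_div_cancel₀ _ hlam]
    choose l hl hle using hlog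
    have hψd : ∀ i (k : ℤ), ∀ x ∈ ball a R,
        HasDerivAt (fun x => l i x + k * (2 * Real.pi * Complex.I)) (deriv (φ i) x / φ i x) x :=
      fun i k x hx => (hl i x hx).add_const _
    refine ⟨ι × ℤ, fun p x => l p.1 x + p.2 * (2 * Real.pi * Complex.I), ?_, ?_, ?_⟩
    · rintro ⟨i, k⟩
      refine ⟨fun x hx => (hψd i k x hx).differentiableAt.differentiableWithinAt, fun x hx => ?_⟩
      rw [Function.iterate_succ_apply, expMap_add_int_mul, hle i x hx, (hφ i).right_inv x hx]
    · intro x hx w hw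
      rw [Function.iterate_succ_apply] at hw
      obtain ⟨i, hi⟩ := hsurj x hx _ hw
      rw [← hle i x hx, eq_comm, expMap_eq_iff hlam] at hi
      obtain ⟨k, hk⟩ := hi
      exact ⟨(i, k), hk.symm⟩
    · intro x hx g
      rw [Function.iterate_succ_apply, hT x hx, ENNReal.tsum_prod (f := fun i (k : ℤ) =>
        g (l i x + k * (2 * Real.pi * Complex.I)) * ENNReal.ofReal
          (‖deriv (fun x => l i x + k * (2 * Real.pi * Complex.I)) x‖ ^ 2))]
      refine tsum_congr fun i => ?_
      -- The principal logarithm in `logBranch` and the holomorphic `l i` differ at `x` by a period;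
      -- reindexing by `m`, which may depend on `x`, leaves the sum unchanged.
      obtain ⟨m, hm⟩ := (expMap_eq_iff hlam).1
        ((expMap_logBranch hlam 0 (hne i x hx)).trans (hle i x hx).symm)
      have h1 : ∀ k : ℤ, logBranch lam k (φ i x) =
          l i x + ((Equiv.addRight m k : ℤ) : ℂ) * (2 * Real.pi * Complex.I) := by
        intro k
        simp only [logBranch, Int.cast_zero, zero_mul, add_zero] at hm ⊢
        rw [hm, Equiv.coe_addRight]
        push_cast
        ring
      have h0 : 0 < ‖φ i x‖ := norm_pos_iff.2 (hne i x hx)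
      simp only [transfer, h1]
      rw [Equiv.tsum_eq (Equiv.addRight m) (fun k : ℤ =>
        g (l i x + k * (2 * Real.pi * Complex.I)) * ENNReal.ofReal ((‖φ i x‖ ^ 2)⁻¹)),
        ← ENNReal.tsum_mul_right]
      refine tsum_congr fun k => ?_
      rw [(hψd i k x hx).deriv, mul_assoc, ← ENNReal.ofReal_mul (by positivity), norm_div]
      congr 2
      field_simp

lemma exists_inverseBranch (hlam : lam ≠ 0) {a : ℂ} {R : ℝ}
    (hd : Disjoint (ball a R) (postOrbit lam)) (n : ℕ) {x w : ℂ} (hx : x ∈ ball a R)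
    (hw : (expMap lam)^[n] w = x) :
    ∃ φ, IsInverseBranch (expMap lam)^[n] φ a R ∧ φ x = w := by
  obtain ⟨ι, φ, hφ, hsurj, -⟩ := exists_inverseBranches hlam hd n
  obtain ⟨i, hi⟩ := hsurj x hx w hw
  exact ⟨φ i, hφ i, hi⟩

/-- Inverse branches of the iterates have derivatives bounded in terms of the size of the disc. -/
lemma IsInverseBranch.norm_deriv_mul_le {φ : ℂ → ℂ} {a : ℂ} {R : ℝ} {n : ℕ}
    (h : IsInverseBranch (expMap lam)^[n + 1] φ a R) (hR : 0 < R) : ‖deriv φ a‖ * R ≤ 2000 := by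
  refine norm_deriv_mul_le_of_ne_translate hR h.diff fun x hx y hy hxy => ?_
  have h1 : (expMap lam)^[n + 1] (φ x) = (expMap lam)^[n + 1] (φ y) := by
    have := expMap_add_int_mul lam (φ y) 1
    rw [Int.cast_one, one_mul] at this
    rw [Function.iterate_succ_apply, Function.iterate_succ_apply, hxy, this]
  rw [h.right_inv x hx, h.right_inv y hy] at h1
  subst h1
  have : (2 * Real.pi * Complex.I : ℂ) = 0 := by linear_combination -hxy
  simp [Real.pi_ne_zero] at this

lemma IsInverseBranch.norm_sub_le_mul {F φ : ℂ → ℂ} {a : ℂ} {R : ℝ} (h : IsInverseBranch F φ a R)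
    (hF : Differentiable ℂ F) {x y z : ℂ} (hx : x ∈ ball a (R / 2)) (hy : y ∈ ball a (R / 2))
    (hz : z ∈ ball a (R / 2)) :
    ‖φ x - φ y‖ ≤ distortionConst * ‖deriv φ z‖ * ‖x - y‖ := by
  have hR : 0 < R := by linarith [nonempty_ball.1 ⟨x, hx⟩]
  have hsub : ball a (R / 2) ⊆ ball a R := ball_subset_ball (by linarith)
  exact (convex_ball a (R / 2)).norm_image_sub_le_of_norm_hasDerivWithin_le
    (fun w hw => (h.hasDerivAt (hsub hw)).hasDerivWithinAt)
    (fun w hw => h.norm_deriv_le hF hw hz) hy hx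

/-! ### Regularity of iterated densities -/

/-- An integrable density with bounded oscillation at bounded scales. -/
noncomputable def baseDensity (z : ℂ) : ENNReal := ENNReal.ofReal ((1 + ‖z‖) ^ (-3 : ℝ))

lemma measurable_baseDensity : Measurable baseDensity := by
  unfold baseDensity
  fun_prop

lemma lintegral_baseDensity_lt_top : ∫⁻ z, baseDensity z < ⊤ :=
  finite_integral_one_add_norm (by simp; norm_num)

lemma baseDensity_pos (z : ℂ) : 0 < baseDensity z :=
  ENNReal.ofReal_pos.2 (by positivity)

lemma baseDensity_le {x y : ℂ} {C : ℝ} (h : ‖x - y‖ ≤ C) :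
    baseDensity x ≤ ENNReal.ofReal ((1 + C) ^ 3) * baseDensity y := by
  have hC : 0 ≤ C := (norm_nonneg _).trans h
  rw [baseDensity, baseDensity, ← ENNReal.ofReal_mul (by positivity)]
  refine ENNReal.ofReal_le_ofReal ?_
  have h1 : 1 + ‖y‖ ≤ (1 + C) * (1 + ‖x‖) := by
    have := norm_sub_norm_le y x
    rw [norm_sub_rev] at this
    nlinarith [norm_nonneg x]
  have key : ∀ t : ℝ, 0 ≤ t → (1 + t) ^ (-3 : ℝ) = ((1 + t) ^ 3)⁻¹ := fun t ht => by
    rw [Real.rpow_neg (by positivity)]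
    norm_cast
  rw [key _ (norm_nonneg x), key _ (norm_nonneg y), ← div_eq_mul_inv, inv_eq_one_div,
    div_le_div_iff₀ (by positivity) (by positivity), one_mul, ← mul_pow]
  exact pow_le_pow_left₀ (by positivity) h1 3

/-- The oscillation constant of iterated densities on discs of radius `r`. -/
noncomputable def oscConst (r : ℝ) : ENNReal :=
  ENNReal.ofReal ((1 + (4000 + 2 * r)) ^ 3) * ENNReal.ofReal (distortionConst ^ 2)

lemma oscConst_ne_top (r : ℝ) : oscConst r ≠ ⊤ :=
  ENNReal.mul_ne_top ENNReal.ofReal_ne_top ENNReal.ofReal_ne_top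

/-- Harnack inequality, uniform in n, by comparing the sums over inverse branches term by term: the
Bloch bound keeps φ(x) and φ(y) at bounded distance, where the base density is comparable, and
distortion compares the derivatives. -/
lemma transfer_iterate_baseDensity_le (hlam : lam ≠ 0) {a : ℂ} {r : ℝ}
    (hd : Disjoint (ball a (2 * r)) (postOrbit lam)) (n : ℕ) {x y : ℂ}
    (hx : x ∈ ball a r) (hy : y ∈ ball a r) :
    (transfer lam)^[n] baseDensity x ≤ oscConst r * (transfer lam)^[n] baseDensity y := by
  have hr : 0 < r := nonempty_ball.1 ⟨x, hx⟩
  have hsub : ball a r ⊆ ball a (2 * r) := ball_subset_ball (by linarith)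
  have hhalf : 2 * r / 2 = r := by ring
  obtain ⟨ι, φ, hφ, -, hT⟩ := exists_inverseBranches hlam hd n
  have hxy : ‖x - y‖ ≤ 2 * r := by
    rw [← dist_eq_norm]
    have := dist_triangle_right x y a
    rw [mem_ball] at hx hy
    linarith
  have hdist : ∀ i, ‖φ i x - φ i y‖ ≤ 4000 + 2 * r := by
    intro i
    cases n with
    -- The only branch is the identity, to which the Bloch bound for positive iterates does not
    -- apply.
    | zero =>
      have h1 := (hφ i).right_inv x (hsub hx)
      have h2 := (hφ i).right_inv y (hsub hy)
      simp only [Function.iterate_zero, id] at h1 h2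
      rw [h1, h2]
      linarith
    | succ n =>
      have hbd : ∀ z ∈ ball a r, ‖deriv (φ i) z‖ ≤ 2000 / r := by
        intro z hz
        rw [le_div_iff₀ hr]
        exact ((hφ i).mono (ball_subset_ball' (by rw [mem_ball] at hz; linarith))).norm_deriv_mul_le
          hr
      have := (convex_ball a r).norm_image_sub_le_of_norm_hasDerivWithin_le
        (fun w hw => ((hφ i).hasDerivAt (hsub hw)).hasDerivWithinAt) hbd hy hx
      calc _ ≤ 2000 / r * ‖x - y‖ := this
        _ ≤ 2000 / r * (2 * r) := by gcongr
        _ = 4000 := by field_simp; norm_num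
        _ ≤ _ := by linarith
  rw [hT x (hsub hx), hT y (hsub hy), ← ENNReal.tsum_mul_left]
  refine ENNReal.tsum_le_tsum fun i => ?_
  have h1 := baseDensity_le (hdist i)
  have h2 : ENNReal.ofReal (‖deriv (φ i) x‖ ^ 2) ≤
      ENNReal.ofReal (distortionConst ^ 2) * ENNReal.ofReal (‖deriv (φ i) y‖ ^ 2) := by
    rw [← ENNReal.ofReal_mul (by positivity), ← mul_pow]
    refine ENNReal.ofReal_le_ofReal (pow_le_pow_left₀ (norm_nonneg _) ?_ 2)
    exact (hφ i).norm_deriv_le (differentiable_iterate lam n) (by rwa [hhalf]) (by rwa [hhalf])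
  calc _ ≤ _ := mul_le_mul' h1 h2
    _ = _ := by rw [oscConst]; ring

/-! ### The limit density -/

lemma exists_ball_disjoint_postOrbit {x : ℂ} (hx : x ∉ postOrbit lam) :
    ∃ r > 0, Disjoint (ball x (2 * r)) (postOrbit lam) := by
  obtain ⟨ε, hε, h⟩ := Metric.isOpen_iff.1 (isClosed_postOrbit lam).isOpen_compl x hx
  refine ⟨ε / 2, by positivity, ?_⟩
  rw [mul_div_cancel₀ _ two_ne_zero]
  exact disjoint_left.2 fun y hy hz => h hy hz

/-- The sum of the first `n` iterates of the base density under the transfer operator. -/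
noncomputable def densitySum (lam : ℂ) (n : ℕ) : ℂ → ENNReal :=
  ∑ k ∈ Finset.range n, (transfer lam)^[k] baseDensity

lemma densitySum_apply (n : ℕ) (x : ℂ) :
    densitySum lam n x = ∑ k ∈ Finset.range n, (transfer lam)^[k] baseDensity x := by
  rw [densitySum, Finset.sum_apply]

lemma measurable_densitySum (n : ℕ) : Measurable (densitySum lam n) := by
  rw [funext (densitySum_apply n)]
  exact Finset.measurable_sum _ fun k _ => measurable_transfer_iterate measurable_baseDensity k

lemma densitySum_le (hlam : lam ≠ 0) {a : ℂ} {r : ℝ}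
    (hd : Disjoint (ball a (2 * r)) (postOrbit lam)) (n : ℕ) {x y : ℂ}
    (hx : x ∈ ball a r) (hy : y ∈ ball a r) :
    densitySum lam n x ≤ oscConst r * densitySum lam n y := by
  rw [densitySum_apply, densitySum_apply, Finset.mul_sum]
  exact Finset.sum_le_sum fun k _ => transfer_iterate_baseDensity_le hlam hd k hx hy

/-- The total mass of the iterates is constant, and Harnack turns the mass on a disc into a
pointwise bound. -/
lemma exists_transfer_iterate_le (hlam : lam ≠ 0) {x : ℂ} (hx : x ∉ postOrbit lam) :
    ∃ C : ENNReal, C ≠ ⊤ ∧ ∀ n, (transfer lam)^[n] baseDensity x ≤ C := by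
  obtain ⟨r, hr, hd⟩ := exists_ball_disjoint_postOrbit hx
  have hv0 : volume (ball x r) ≠ 0 := (measure_ball_pos _ _ hr).ne'
  have hvt : volume (ball x r) ≠ ⊤ := measure_ball_lt_top.ne
  refine ⟨oscConst r * (∫⁻ z, baseDensity z) / volume (ball x r),
    ENNReal.div_ne_top (ENNReal.mul_ne_top (oscConst_ne_top r) lintegral_baseDensity_lt_top.ne)
      hv0, fun n => ?_⟩
  rw [ENNReal.le_div_iff_mul_le (Or.inl hv0) (Or.inl hvt), ← setLIntegral_const]
  calc ∫⁻ _ in ball x r, (transfer lam)^[n] baseDensity x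
      ≤ ∫⁻ y in ball x r, oscConst r * (transfer lam)^[n] baseDensity y :=
        setLIntegral_mono' measurableSet_ball fun y hy =>
          transfer_iterate_baseDensity_le hlam hd n (mem_ball_self hr) hy
    _ = oscConst r * ∫⁻ y in ball x r, (transfer lam)^[n] baseDensity y :=
        lintegral_const_mul _ (measurable_transfer_iterate measurable_baseDensity n)
    _ ≤ oscConst r * ∫⁻ y, (transfer lam)^[n] baseDensity y := by
        gcongr
        exact Measure.restrict_le_self
    _ = _ := by rw [lintegral_transfer_iterate hlam measurable_baseDensity]

lemma densitySum_ne_top (hlam : lam ≠ 0) {x : ℂ} (hx : x ∉ postOrbit lam) (n : ℕ) :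
    densitySum lam n x ≠ ⊤ := by
  obtain ⟨C, hC, h⟩ := exists_transfer_iterate_le hlam hx
  rw [densitySum_apply]
  exact ENNReal.sum_ne_top.2 fun k _ => ((h k).trans_lt hC.lt_top).ne

lemma densitySum_succ_ne_zero (n : ℕ) (x : ℂ) : densitySum lam (n + 1) x ≠ 0 := by
  rw [densitySum_apply, Finset.sum_range_succ']
  exact ((baseDensity_pos x).trans_le le_add_self).ne'

/-- Telescoping: T S_n + g = S_n + T^n g. -/
lemma transfer_densitySum_le (n : ℕ) (x : ℂ) :
    transfer lam (densitySum lam n) x ≤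
      densitySum lam n x + (transfer lam)^[n] baseDensity x := by
  rw [densitySum, transfer_sum, Finset.sum_apply, Finset.sum_apply, ← Finset.sum_range_succ
    (fun k => (transfer lam)^[k] baseDensity x), Finset.sum_range_succ']
  simp only [← Function.iterate_succ_apply' (transfer lam)]
  exact le_self_add

/-- Fatou's lemma for the transfer operator. -/
lemma transfer_liminf_le (v : ℕ → ℂ → ENNReal) (x : ℂ) :
    transfer lam (fun z => liminf (fun n => v n z) atTop) x ≤
      liminf (fun n => transfer lam (v n) x) atTop := by
  simp only [transfer]
  -- The sum over branches is an integral for counting measure.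
  have h := lintegral_liminf_le (μ := (Measure.count : Measure ℤ)) (u := atTop)
    (f := fun n k => v n (logBranch lam k x) * ENNReal.ofReal ((‖x‖ ^ 2)⁻¹))
    (fun n => measurable_from_top)
  simp only [lintegral_count] at h
  refine le_trans (ENNReal.tsum_le_tsum fun k => ?_) h
  rw [ENNReal.liminf_mul_const_of_ne_top ENNReal.ofReal_ne_top, mul_comm]

/-- The limit of the normalised sums of iterated densities. -/
noncomputable def limitDensity (lam a x : ℂ) : ENNReal :=
  liminf (fun n => densitySum lam n x * (densitySum lam n a)⁻¹) atTop

lemma measurable_limitDensity (lam a : ℂ) : Measurable (limitDensity lam a) :=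
  Measurable.liminf fun n => (measurable_densitySum n).mul_const _

lemma limitDensity_le (hlam : lam ≠ 0) (a : ℂ) {b : ℂ} {r : ℝ}
    (hd : Disjoint (ball b (2 * r)) (postOrbit lam)) {x y : ℂ}
    (hx : x ∈ ball b r) (hy : y ∈ ball b r) :
    limitDensity lam a x ≤ oscConst r * limitDensity lam a y := by
  rw [limitDensity, limitDensity, ← ENNReal.liminf_const_mul_of_ne_top (oscConst_ne_top r)]
  refine liminf_le_liminf (Eventually.of_forall fun n => ?_)
  rw [← mul_assoc]
  exact mul_le_mul_left (densitySum_le hlam hd n hx hy) _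

lemma limitDensity_self (hlam : lam ≠ 0) {a : ℂ} (ha : a ∉ postOrbit lam) :
    limitDensity lam a a = 1 := by
  rw [limitDensity, liminf_congr (v := fun _ => (1 : ENNReal)) ?_, liminf_const]
  -- The empty sum at n = 0 is zero and cannot be normalised.
  filter_upwards [eventually_ge_atTop 1] with n hn
  obtain ⟨n, rfl⟩ := Nat.exists_eq_add_of_le' hn
  exact ENNReal.mul_inv_cancel (densitySum_succ_ne_zero n a) (densitySum_ne_top hlam ha _)

/-- Fatou gives only an inequality; the telescoping error T^n g(x) is bounded in n and disappears
after division by S_n(a) → ∞. -/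
lemma transfer_limitDensity_le (hlam : lam ≠ 0) {a : ℂ}
    (ha : Tendsto (fun n => densitySum lam n a) atTop (𝓝 ⊤)) {x : ℂ} (hx : x ∉ postOrbit lam) :
    transfer lam (limitDensity lam a) x ≤ limitDensity lam a x := by
  obtain ⟨C, hC, hbd⟩ := exists_transfer_iterate_le hlam hx
  refine (transfer_liminf_le _ x).trans ?_
  have h0 : Tendsto (fun n => (transfer lam)^[n] baseDensity x * (densitySum lam n a)⁻¹) atTop
      (𝓝 0) := by
    have h1 : Tendsto (fun n => C * (densitySum lam n a)⁻¹) atTop (𝓝 (C * (⊤ : ENNReal)⁻¹)) :=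
      ENNReal.Tendsto.const_mul (tendsto_inv_iff.2 ha) (Or.inr hC)
    rw [ENNReal.inv_top, mul_zero] at h1
    exact tendsto_of_tendsto_of_tendsto_of_le_of_le tendsto_const_nhds h1
      (fun n => zero_le) (fun n => mul_le_mul_left (hbd n) _)
  refine le_trans ?_ (ENNReal.liminf_add_of_right_tendsto_zero h0 _).le
  refine liminf_le_liminf (Eventually.of_forall fun n => ?_)
  simp only [transfer_mul_const, Pi.add_apply]
  rw [← add_mul]
  exact mul_le_mul_left (transfer_densitySum_le n x) _

lemma sum_setLIntegral_baseDensity_le (hlam : lam ≠ 0) {a : ℂ} {r : ℝ} (hr : 0 < r)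
    (hd : Disjoint (ball a (2 * r)) (postOrbit lam)) (n : ℕ) :
    ∑ k ∈ Finset.range n, ∫⁻ z in (expMap lam)^[k] ⁻¹' ball a r, baseDensity z ≤
      densitySum lam n a * (oscConst r * volume (ball a r)) := by
  simp only [setLIntegral_preimage_iterate hlam measurableSet_ball measurable_baseDensity]
  rw [← lintegral_finsetSum _ fun k _ => measurable_transfer_iterate measurable_baseDensity k]
  simp only [← densitySum_apply]
  calc ∫⁻ x in ball a r, densitySum lam n x
      ≤ ∫⁻ _ in ball a r, oscConst r * densitySum lam n a :=
        setLIntegral_mono' measurableSet_ball fun y hy =>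
          densitySum_le hlam hd n hy (mem_ball_self hr)
    _ = _ := by rw [setLIntegral_const]; ring

lemma tendsto_densitySum (hlam : lam ≠ 0) {a : ℂ} {r : ℝ} (hr : 0 < r)
    (hd : Disjoint (ball a (2 * r)) (postOrbit lam))
    (h : ∑' k, ∫⁻ z in (expMap lam)^[k] ⁻¹' ball a r, baseDensity z = ⊤) :
    Tendsto (fun n => densitySum lam n a) atTop (𝓝 ⊤) := by
  have h1 := ENNReal.tendsto_nat_tsum
    fun k => ∫⁻ z in (expMap lam)^[k] ⁻¹' ball a r, baseDensity z
  rw [h] at h1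
  set c := oscConst r * volume (ball a r)
  have hc : c ≠ ⊤ := ENNReal.mul_ne_top (oscConst_ne_top r) measure_ball_lt_top.ne
  have h2 := ENNReal.Tendsto.mul_const (b := c⁻¹) h1 (Or.inl ENNReal.top_ne_zero)
  rw [ENNReal.top_mul (ENNReal.inv_ne_zero.2 hc)] at h2
  refine tendsto_nhds_top_mono h2 (Eventually.of_forall fun n => ?_)
  simp only [← div_eq_mul_inv]
  exact ENNReal.div_le_of_le_mul (sum_setLIntegral_baseDensity_le hlam hr hd n)

/-! ### Recurrence -/

/-- The points whose orbit visits `B` infinitely often. -/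
def recurrentSet (lam : ℂ) (B : Set ℂ) : Set ℂ := {z | ∃ᶠ n in atTop, (expMap lam)^[n] z ∈ B}

lemma measurableSet_recurrentSet (lam : ℂ) {B : Set ℂ} (hB : MeasurableSet B) :
    MeasurableSet (recurrentSet lam B) := by
  have : recurrentSet lam B = ⋂ N : ℕ, ⋃ n : ℕ, ⋃ _ : N ≤ n, (expMap lam)^[n] ⁻¹' B := by
    ext z
    simp [recurrentSet, frequently_atTop]
  rw [this]
  exact MeasurableSet.iInter fun N => MeasurableSet.iUnion fun n => MeasurableSet.iUnion fun _ =>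
    measurable_iterate lam n hB

lemma preimage_recurrentSet (lam : ℂ) (B : Set ℂ) :
    expMap lam ⁻¹' recurrentSet lam B = recurrentSet lam B := by
  ext z
  simp only [recurrentSet, mem_preimage, mem_ofPred_eq, ← Function.iterate_succ_apply]
  constructor
  · intro h
    rw [frequently_atTop] at h ⊢
    intro N
    obtain ⟨n, hn, hz⟩ := h N
    exact ⟨n + 1, by lia, hz⟩
  · intro h
    rw [frequently_atTop] at h ⊢
    intro N
    obtain ⟨n, hn, hz⟩ := h (N + 1)
    obtain ⟨n, rfl⟩ := Nat.exists_eq_add_of_le' (show 1 ≤ n by lia)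
    exact ⟨n, by lia, hz⟩

lemma iterate_mem_recurrentSet_iff {B : Set ℂ} (n : ℕ) {z : ℂ} :
    (expMap lam)^[n] z ∈ recurrentSet lam B ↔ z ∈ recurrentSet lam B := by
  induction n with
  | zero => rfl
  | succ n ih =>
    rw [Function.iterate_succ_apply', ← ih, ← mem_preimage (f := expMap lam),
      preimage_recurrentSet]

lemma disjoint_recurrentSet_postOrbit {B : Set ℂ} (hB : Disjoint B (postOrbit lam)) :
    Disjoint (recurrentSet lam B) (postOrbit lam) := by
  refine disjoint_left.2 fun z hz hzP => ?_
  obtain ⟨n, hn⟩ := Frequently.exists hz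
  exact disjoint_left.1 hB hn (iterate_mem_postOrbit hzP n)

/-- A Borel–Cantelli argument: a recurrent point is counted infinitely often on the right. The
factor `⊤` encodes the alternative that h has integral zero over the recurrent set or the sum
diverges. -/
lemma top_mul_setLIntegral_le {B : Set ℂ} (hB : MeasurableSet B) {h : ℂ → ENNReal}
    (hh : Measurable h) :
    ⊤ * ∫⁻ z in recurrentSet lam B, h z ≤ ∑' k, ∫⁻ z in (expMap lam)^[k] ⁻¹' B, h z := by
  have hm : ∀ k, MeasurableSet ((expMap lam)^[k] ⁻¹' B) := fun k => measurable_iterate lam k hB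
  simp only [← lintegral_indicator (hm _)]
  rw [← lintegral_tsum fun k => (hh.indicator (hm k)).aemeasurable, ← lintegral_const_mul _ hh,
    ← lintegral_indicator (measurableSet_recurrentSet lam hB)]
  refine lintegral_mono fun z => ?_
  by_cases hz : z ∈ recurrentSet lam B
  · rw [indicator_of_mem hz]
    rcases eq_or_ne (h z) 0 with h0 | h0
    · rw [h0, mul_zero]; exact zero_le
    have hinf : {k | (expMap lam)^[k] z ∈ B}.Infinite := Nat.frequently_atTop_iff_infinite.1 hz
    have := hinf.to_subtype
    have h1 : ∑' k, ((expMap lam)^[k] ⁻¹' B).indicator h z =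
        ∑' k, {k | (expMap lam)^[k] z ∈ B}.indicator (fun _ => h z) k :=
      tsum_congr fun k => by
        by_cases hk : (expMap lam)^[k] z ∈ B <;> simp [indicator, hk]
    rw [h1, ← tsum_subtype, ENNReal.tsum_const_eq_top_of_ne_zero h0]
    exact le_top
  · rw [indicator_of_notMem hz]; exact zero_le

lemma transfer_iterate_le_of_transfer_le {v : ℂ → ENNReal} (h : transfer lam v ≤ v) (n : ℕ) :
    (transfer lam)^[n] v ≤ v := by
  induction n with
  | zero => exact le_rfl
  | succ n ih =>
    rw [Function.iterate_succ_apply']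
    exact le_trans (fun x => ENNReal.tsum_le_tsum fun k => mul_le_mul_left (ih _) _) h

lemma sum_transfer_iterate_le {v d : ℂ → ENNReal} (h : v = d + transfer lam v) (n : ℕ) :
    ∑ k ∈ Finset.range n, (transfer lam)^[k] d + (transfer lam)^[n] v = v := by
  induction n with
  | zero => simp
  | succ n ih =>
    have hadd : ∀ g h : ℂ → ENNReal, (transfer lam)^[n] (g + h) =
        (transfer lam)^[n] g + (transfer lam)^[n] h := by
      clear ih
      induction n with
      | zero => exact fun _ _ => rfl
      | succ n ih =>
        intro g h
        simp only [Function.iterate_succ_apply', ih, transfer_add]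
    rw [Finset.sum_range_succ, add_assoc, Function.iterate_succ_apply, ← hadd, ← h, ih]

/-- An excessive density supported on a set of points that return infinitely often to a set on
which it is integrable is invariant. -/
lemma transfer_ae_eq_of_le (hlam : lam ≠ 0) {B : Set ℂ} (hB : MeasurableSet B) {v : ℂ → ENNReal}
    (hv : Measurable v) (hle : transfer lam v ≤ v)
    (hsupp : ∀ z ∉ recurrentSet lam B, v z = 0) (hfin : ∫⁻ x in B, v x ≠ ⊤) :
    transfer lam v =ᵐ[volume] v := by
  set d : ℂ → ENNReal := v - transfer lam v with hd
  have hdm : Measurable d := hv.sub (measurable_transfer hv)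
  have hvd : v = d + transfer lam v := by
    ext x
    exact (tsub_add_cancel_of_le (hle x)).symm
  -- By duality the partial sums are integrals over B of ∑ T^k d, which telescopes to at most v.
  have hsum : ∑' k, ∫⁻ z in (expMap lam)^[k] ⁻¹' B, d z ≤ ∫⁻ x in B, v x := by
    refine ENNReal.tsum_le_of_sum_range_le fun n => ?_
    simp only [setLIntegral_preimage_iterate hlam hB hdm]
    rw [← lintegral_finsetSum _ fun k _ => measurable_transfer_iterate hdm k]
    refine lintegral_mono fun x => ?_
    have h1 := congrFun (sum_transfer_iterate_le hvd n) x
    rw [Pi.add_apply, Finset.sum_apply] at h1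
    exact h1 ▸ le_self_add
  have hE := measurableSet_recurrentSet lam hB
  have hz : ∫⁻ z in recurrentSet lam B, d z = 0 := by
    by_contra hne
    have h1 := (top_mul_setLIntegral_le (lam := lam) hB hdm).trans hsum
    rw [ENNReal.top_mul hne, top_le_iff] at h1
    exact hfin h1
  rw [lintegral_eq_zero_iff hdm, EventuallyEq, ae_restrict_iff' hE] at hz
  filter_upwards [hz] with z hz
  refine le_antisymm (hle z) ?_
  by_cases hzE : z ∈ recurrentSet lam B
  · have h2 : v z - transfer lam v z = 0 := hz hzE
    exact tsub_eq_zero_iff_le.1 h2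
  · rw [hsupp z hzE]; exact zero_le

lemma measurePreserving_withDensity (hlam : lam ≠ 0) {v : ℂ → ENNReal} (hv : Measurable v)
    (h : transfer lam v =ᵐ[volume] v) :
    MeasurePreserving (expMap lam) (volume.withDensity v) (volume.withDensity v) := by
  refine ⟨measurable_expMap lam, Measure.ext fun A hA => ?_⟩
  rw [Measure.map_apply (measurable_expMap lam) hA, withDensity_apply _ hA,
    withDensity_apply _ (measurable_expMap lam hA), setLIntegral_preimage hlam hA hv]
  exact lintegral_congr_ae (ae_restrict_of_ae h)

/-- Every recurrent point enters `B`, remaining recurrent, and preimages of null sets under iterates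
are null. -/
lemma volume_inter_recurrentSet_pos (hlam : lam ≠ 0) {B : Set ℂ} (hB : MeasurableSet B)
    (hE : 0 < volume (recurrentSet lam B)) : 0 < volume (B ∩ recurrentSet lam B) := by
  by_contra! h
  have h0 : volume (B ∩ recurrentSet lam B) = 0 := le_antisymm h zero_le
  refine hE.ne' (measure_mono_null ?_ (measure_iUnion_null fun n =>
    volume_preimage_iterate_eq_zero hlam (hB.inter (measurableSet_recurrentSet lam hB)) h0 n))
  intro z hz
  obtain ⟨n, hn⟩ := Frequently.exists hz
  exact mem_iUnion.2 ⟨n, hn, (iterate_mem_recurrentSet_iff n).2 hz⟩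

theorem exists_sigmaFinite_isACInvariant (hlam : lam ≠ 0) {a : ℂ} {r : ℝ} (hr : 0 < r)
    (hd : Disjoint (ball a (2 * r)) (postOrbit lam))
    (hE : 0 < volume (recurrentSet lam (ball a r))) :
    ∃ μ : Measure ℂ, SigmaFinite μ ∧ IsACInvariant (expMap lam) μ := by
  set B := ball a r with hB
  set E := recurrentSet lam B with hEdef
  have hBm : MeasurableSet B := measurableSet_ball
  have hEm : MeasurableSet E := measurableSet_recurrentSet lam hBm
  have haP : a ∉ postOrbit lam := disjoint_left.1 hd (mem_ball_self (by positivity))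
  have hEP : Disjoint E (postOrbit lam) := disjoint_recurrentSet_postOrbit
    (hd.mono_left (ball_subset_ball (by linarith)))
  have htop : ∑' k, ∫⁻ z in (expMap lam)^[k] ⁻¹' B, baseDensity z = ⊤ := by
    have h1 := top_mul_setLIntegral_le (lam := lam) hBm measurable_baseDensity
    rw [ENNReal.top_mul, top_le_iff] at h1
    · exact h1
    · refine (setLIntegral_pos_iff measurable_baseDensity).2 ?_ |>.ne'
      rwa [Function.support_eq_univ fun z => (baseDensity_pos z).ne', univ_inter]
  have hlim := tendsto_densitySum hlam hr hd htop
  -- Restriction to the completely invariant set E commutes with T. It makes the density excessive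
  -- also on P, where no pointwise bound is available, and supports it on recurrent points.
  set v := E.indicator (limitDensity lam a) with hv
  have hvm : Measurable v := (measurable_limitDensity lam a).indicator hEm
  have hle : transfer lam v ≤ v := by
    rw [hv, transfer_indicator hlam (preimage_recurrentSet lam B), ← hEdef]
    intro x
    by_cases hx : x ∈ E
    · simp only [indicator_of_mem hx]
      exact transfer_limitDensity_le hlam hlim (disjoint_left.1 hEP hx)
    · simp only [indicator_of_notMem hx]
      exact le_rfl
  have hbd : ∀ x ∈ B, limitDensity lam a x ≤ oscConst r := fun x hx => by
    have := limitDensity_le hlam a hd hx (mem_ball_self hr)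
    rwa [limitDensity_self hlam haP, mul_one] at this
  have hfin : ∫⁻ x in B, v x ≠ ⊤ := by
    refine ((setLIntegral_mono' (g := fun _ => oscConst r) hBm fun x hx => ?_).trans_lt ?_).ne
    · exact (indicator_le_self _ _ x).trans (hbd x hx)
    · rw [setLIntegral_const]
      exact ENNReal.mul_lt_top (oscConst_ne_top r).lt_top measure_ball_lt_top
  have hae := transfer_ae_eq_of_le hlam hBm hvm hle
    (fun z hz => indicator_of_notMem hz _) hfin
  refine ⟨volume.withDensity v, ?_, ?_, withDensity_absolutelyContinuous _ _,
    measurePreserving_withDensity hlam hvm hae⟩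
  · refine SigmaFinite.withDensity_of_ne_top ?_
    -- The integral of v over the n-th preimage of B is that of T^n v ≤ v over B, and these
    -- preimages cover E.
    have h1 : ∀ n : ℕ, ∀ᵐ x, x ∈ (expMap lam)^[n] ⁻¹' B → v x < ⊤ := by
      intro n
      rw [← ae_restrict_iff' (measurable_iterate lam n hBm)]
      refine ae_lt_top hvm ?_
      rw [setLIntegral_preimage_iterate hlam hBm hvm]
      exact ((lintegral_mono (transfer_iterate_le_of_transfer_le hle n)).trans_lt
        hfin.lt_top).ne
    filter_upwards [ae_all_iff.2 h1] with x hx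
    by_cases hxE : x ∈ E
    · obtain ⟨n, hn⟩ := Frequently.exists hxE
      exact (hx n hn).ne
    · rw [hv, indicator_of_notMem hxE]; exact ENNReal.zero_ne_top
  · intro h0
    have h1 : volume.withDensity v (B ∩ E) = 0 := by rw [h0]; rfl
    rw [withDensity_apply _ (hBm.inter hEm)] at h1
    refine (setLIntegral_pos_iff hvm).2 ?_ |>.ne' h1
    have : Function.support v ∩ (B ∩ E) = B ∩ E := by
      refine inter_eq_right.2 fun x hx => ?_
      rw [Function.mem_support, hv, indicator_of_mem hx.2]
      intro hx0
      have := limitDensity_le hlam a hd (mem_ball_self hr) hx.1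
      rw [limitDensity_self hlam haP, hx0, mul_zero] at this
      exact one_ne_zero (le_antisymm this zero_le)
    rw [this]
    exact volume_inter_recurrentSet_pos hlam hBm hE

/-! ### Limit points outside the post-singular set -/

/-- The point ∞ lies in the post-singular set and ℂ is open in the sphere, so only finite cluster
points matter. -/
lemma not_omegaLimitSet_subset_iff {z : ℂ} :
    ¬ omegaLimitSet (expMap lam) z ⊆ postSingularSet lam ↔
      ∃ p ∉ postOrbit lam, MapClusterPt p atTop fun n => (expMap lam)^[n] z := by
  have key : ∀ p : ℂ, (p : OnePoint ℂ) ∈ omegaLimitSet (expMap lam) z ↔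
      MapClusterPt p atTop fun n => (expMap lam)^[n] z := by
    intro p
    rw [omegaLimitSet, mem_omegaLimit_iff_frequently, mapClusterPt_iff_frequently]
    simp only [singleton_inter_nonempty, mem_preimage, OnePoint.nhds_coe_eq, mem_map]
    constructor
    · intro h U hU
      have := h ((↑) '' U) (by rwa [preimage_image_eq _ OnePoint.coe_injective])
      simpa [OnePoint.coe_injective.mem_set_image] using this
    · intro h U hU
      exact h _ hU
  have hP : ∀ p : ℂ, (p : OnePoint ℂ) ∈ postSingularSet lam ↔ p ∈ postOrbit lam := by
    intro p
    rw [postSingularSet, mem_insert_iff]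
    simp only [OnePoint.coe_ne_infty, false_or, postOrbit]
    exact OnePoint.coe_injective.mem_set_image
  rw [not_subset]
  constructor
  · rintro ⟨y, hy, hyP⟩
    induction y using OnePoint.rec with
    | infty => exact absurd (mem_insert _ _) hyP
    | coe p => exact ⟨p, fun h => hyP ((hP p).2 h), (key p).1 hy⟩
  · rintro ⟨p, hp, hc⟩
    exact ⟨p, (key p).2 hc, fun h => hp ((hP p).1 h)⟩

lemma exists_recurrentSet_pos
    (h : 0 < volume {z : ℂ | ¬ omegaLimitSet (expMap lam) z ⊆ postSingularSet lam}) :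
    ∃ a r, 0 < r ∧ Disjoint (ball a (2 * r)) (postOrbit lam) ∧
      0 < volume (recurrentSet lam (ball a r)) := by
  by_contra! hcon
  refine h.ne' (measure_mono_null (t := ⋃ (i : ℕ) (m : ℕ) (_ : Disjoint
    (ball (TopologicalSpace.denseSeq ℂ i) (2 * (1 / ((m : ℝ) + 1)))) (postOrbit lam)),
      recurrentSet lam (ball (TopologicalSpace.denseSeq ℂ i) (1 / ((m : ℝ) + 1)))) ?_ ?_)
  · intro z hz
    obtain ⟨p, hp, hc⟩ := not_omegaLimitSet_subset_iff.1 hz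
    obtain ⟨r, hr, hd⟩ := exists_ball_disjoint_postOrbit hp
    -- The centre is moved by less than 1/(m+1) and the doubled disc has radius 2/(m+1), so three
    -- such lengths must fit into 2r.
    obtain ⟨m, hm⟩ := exists_nat_one_div_lt (show (0 : ℝ) < 2 * r / 3 by positivity)
    have hm0 : (0 : ℝ) < 1 / ((m : ℝ) + 1) := by positivity
    obtain ⟨i, hi⟩ := (TopologicalSpace.denseRange_denseSeq ℂ).exists_dist_lt p hm0
    simp only [mem_iUnion]
    refine ⟨i, m, hd.mono_left (ball_subset_ball' ?_), ?_⟩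
    · rw [dist_comm]; linarith
    · exact mapClusterPt_iff_frequently.1 hc _ (isOpen_ball.mem_nhds hi)
  · refine measure_iUnion_null fun i => measure_iUnion_null fun m => measure_iUnion_null fun hd => ?_
    exact le_antisymm (hcon _ _ (by positivity) hd) zero_le

/-! ### Comparison of preimages -/

lemma IsInverseBranch.norm_deriv_iterate_le {φ : ℂ → ℂ} {a : ℂ} {R : ℝ} {F : ℂ → ℂ}
    (h : IsInverseBranch F φ a R) (hF : Differentiable ℂ F) {x y : ℂ} (hx : x ∈ ball a (R / 2))
    (hy : y ∈ ball a (R / 2)) :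
    ‖deriv F (φ x)‖ ≤ distortionConst * ‖deriv F (φ y)‖ := by
  have hsub : ball a (R / 2) ⊆ ball a R :=
    ball_subset_ball (by linarith [nonempty_ball.1 ⟨x, hx⟩])
  have h1 := h.norm_deriv_mul hF (hsub hx)
  have h2 := h.norm_deriv_mul hF (hsub hy)
  have h3 := h.norm_deriv_le hF hy hx
  have hpos : 0 < ‖deriv φ y‖ := norm_pos_iff.2 (h.deriv_ne_zero hF (hsub hy))
  refine le_of_mul_le_mul_right ?_ hpos
  rw [mul_assoc, h2, mul_one]
  calc ‖deriv F (φ x)‖ * ‖deriv φ y‖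
      ≤ ‖deriv F (φ x)‖ * (distortionConst * ‖deriv φ x‖) := by gcongr
    _ = distortionConst * (‖deriv F (φ x)‖ * ‖deriv φ x‖) := by ring
    _ = distortionConst := by rw [h1, mul_one]

/-- Every iterated preimage of a point of `S` has a companion among the iterated preimages of `b`,
at a distance and with a derivative that are comparable uniformly in the number of iterates. -/
def PullbackComparable (lam : ℂ) (S : Set ℂ) (b : ℂ) : Prop :=
  ∃ K > 0, ∀ x ∈ S, ∀ n w, (expMap lam)^[n] w = x → ∃ w', (expMap lam)^[n] w' = b ∧
    ‖w' - w‖ * ‖deriv (expMap lam)^[n] w'‖ ≤ K ∧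
    ‖deriv (expMap lam)^[n] w'‖ ≤ K * ‖deriv (expMap lam)^[n] w‖

lemma pullbackComparable_ball (hlam : lam ≠ 0) {a : ℂ} {r : ℝ} (hr : 0 < r)
    (hd : Disjoint (ball a (2 * r)) (postOrbit lam)) {y : ℂ} (hy : y ∈ ball a r) :
    PullbackComparable lam (ball a r) y := by
  have hK := distortionConst_pos
  refine ⟨distortionConst * (2 * r + 1), by positivity, fun x hx n w hw => ?_⟩
  have hsub : ball a r ⊆ ball a (2 * r) := ball_subset_ball (by linarith)
  have hhalf : ball a r = ball a (2 * r / 2) := by congr 1; ring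
  have hF := differentiable_iterate lam n
  obtain ⟨φ, hφ, rfl⟩ := exists_inverseBranch hlam hd n (hsub hx) hw
  refine ⟨φ y, hφ.right_inv y (hsub hy), ?_, ?_⟩
  · have h1 := hφ.norm_sub_le_mul hF (hhalf ▸ hy) (hhalf ▸ hx) (hhalf ▸ hy)
    have h2 := hφ.norm_deriv_mul hF (hsub hy)
    have hxy : ‖y - x‖ ≤ 2 * r := by
      rw [← dist_eq_norm]
      have := dist_triangle_right y x a
      rw [mem_ball] at hx hy
      linarith
    calc ‖φ y - φ x‖ * ‖deriv (expMap lam)^[n] (φ y)‖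
        ≤ distortionConst * ‖deriv φ y‖ * ‖y - x‖ * ‖deriv (expMap lam)^[n] (φ y)‖ := by gcongr
      _ = distortionConst * ‖y - x‖ * (‖deriv (expMap lam)^[n] (φ y)‖ * ‖deriv φ y‖) := by ring
      _ = distortionConst * ‖y - x‖ := by rw [h2, mul_one]
      _ ≤ distortionConst * (2 * r + 1) := by gcongr; linarith
  · refine (hφ.norm_deriv_iterate_le hF (hhalf ▸ hy) (hhalf ▸ hx)).trans ?_
    have : distortionConst ≤ distortionConst * (2 * r + 1) :=
      le_mul_of_one_le_right hK.le (by linarith)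
    gcongr

lemma PullbackComparable.trans {S : Set ℂ} {b c : ℂ} (h1 : PullbackComparable lam S b)
    (h2 : PullbackComparable lam {b} c) : PullbackComparable lam S c := by
  obtain ⟨K, hK, h1⟩ := h1
  obtain ⟨M, hM, h2⟩ := h2
  refine ⟨M + M * K, by positivity, fun x hx n w hw => ?_⟩
  obtain ⟨w1, hw1, hd1, hq1⟩ := h1 x hx n w hw
  obtain ⟨w2, hw2, hd2, hq2⟩ := h2 b rfl n w1 hw1
  refine ⟨w2, hw2, ?_, ?_⟩
  · calc ‖w2 - w‖ * ‖deriv (expMap lam)^[n] w2‖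
        ≤ (‖w2 - w1‖ + ‖w1 - w‖) * ‖deriv (expMap lam)^[n] w2‖ := by
          gcongr
          exact norm_sub_le_norm_sub_add_norm_sub _ _ _
      _ = ‖w2 - w1‖ * ‖deriv (expMap lam)^[n] w2‖ +
          ‖w1 - w‖ * ‖deriv (expMap lam)^[n] w2‖ := by ring
      _ ≤ M + ‖w1 - w‖ * (M * ‖deriv (expMap lam)^[n] w1‖) := by gcongr
      _ = M + M * (‖w1 - w‖ * ‖deriv (expMap lam)^[n] w1‖) := by ring
      _ ≤ M + M * K := by gcongr
  · calc _ ≤ M * ‖deriv (expMap lam)^[n] w1‖ := hq2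
      _ ≤ M * (K * ‖deriv (expMap lam)^[n] w‖) := by gcongr
      _ ≤ (M + M * K) * ‖deriv (expMap lam)^[n] w‖ := by
          have := norm_nonneg (deriv (expMap lam)^[n] w)
          nlinarith

lemma PullbackComparable.mono {S T : Set ℂ} {b : ℂ} (h : PullbackComparable lam T b)
    (hST : S ⊆ T) : PullbackComparable lam S b := by
  obtain ⟨K, hK, h⟩ := h
  exact ⟨K, hK, fun x hx => h x (hST hx)⟩

/-- Comparability holds both ways within a small disc and is transitive, so it propagates through
the connected complement of P. The constant depends on the two points but not on the iterate. -/
lemma pullbackComparable_of_isPreconnected (hlam : lam ≠ 0)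
    (hconn : IsPreconnected (postOrbit lam)ᶜ) {a b : ℂ} (ha : a ∉ postOrbit lam)
    (hb : b ∉ postOrbit lam) : PullbackComparable lam {a} b := by
  refine hconn.induction₂' (fun x y => PullbackComparable lam {x} y) (fun x hx => ?_)
    (fun x y z _ _ _ h1 h2 => h1.trans h2) ha hb
  obtain ⟨r, hr, hd⟩ := exists_ball_disjoint_postOrbit hx
  refine nhdsWithin_le_nhds ?_
  filter_upwards [ball_mem_nhds x hr] with y hy
  exact ⟨(pullbackComparable_ball hlam hr hd hy).mono (singleton_subset_iff.2 (mem_ball_self hr)),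
    (pullbackComparable_ball hlam hr hd (mem_ball_self hr)).mono (singleton_subset_iff.2 hy)⟩

/-- Reciprocal form of the Bloch bound for the inverse branch. It converts the derivative-weighted
distance in `PullbackComparable` into an honest distance bound. -/
lemma le_norm_deriv_iterate (hlam : lam ≠ 0) {a : ℂ} {R : ℝ} (hR : 0 < R)
    (hd : Disjoint (ball a R) (postOrbit lam)) {n : ℕ} (hn : 1 ≤ n) {w : ℂ}
    (hw : (expMap lam)^[n] w = a) : R / 2000 ≤ ‖deriv (expMap lam)^[n] w‖ := by
  obtain ⟨n, rfl⟩ := Nat.exists_eq_add_of_le' hn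
  obtain ⟨φ, hφ, rfl⟩ := exists_inverseBranch hlam hd (n + 1) (mem_ball_self hR) hw
  have h1 := hφ.norm_deriv_mul_le hR
  have h2 := hφ.norm_deriv_mul (differentiable_iterate lam (n + 1)) (mem_ball_self hR)
  have h3 : 0 ≤ ‖deriv (expMap lam)^[n + 1] (φ a)‖ := norm_nonneg _
  rw [div_le_iff₀ (by norm_num)]
  calc R = ‖deriv (expMap lam)^[n + 1] (φ a)‖ * (‖deriv φ a‖ * R) := by
        rw [← mul_assoc, h2, one_mul]
    _ ≤ _ := by gcongr

lemma exists_period_norm_gt (C : ℝ) :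
    ∃ k : ℤ, C < ‖(k * (2 * Real.pi * Complex.I) : ℂ)‖ := by
  obtain ⟨k, hk⟩ := exists_nat_gt C
  refine ⟨k, ?_⟩
  have : ‖((k : ℤ) * (2 * Real.pi * Complex.I) : ℂ)‖ = k * (2 * Real.pi) := by
    simp [abs_of_pos Real.pi_pos]
  rw [this]
  nlinarith [Real.pi_gt_three, (Nat.cast_nonneg k : (0 : ℝ) ≤ k)]

lemma exists_norm_bound (hb : Bornology.IsBounded (forwardOrbit (expMap lam) 0)) :
    ∃ ρ > 0, ∀ z ∈ postOrbit lam, ‖z‖ ≤ ρ := by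
  obtain ⟨ρ, hρ, h⟩ := hb.closure.exists_pos_norm_le
  exact ⟨ρ, hρ, h⟩

/-- Along bounded sequences of preimages of a point outside the post-singular set the derivatives of
the iterates tend to infinity. -/
lemma exists_lt_norm_deriv_iterate (hlam : lam ≠ 0)
    (hb : Bornology.IsBounded (forwardOrbit (expMap lam) 0))
    (hconn : IsPreconnected (postOrbit lam)ᶜ) {a : ℂ} (ha : a ∉ postOrbit lam) (M C : ℝ) :
    ∃ N, ∀ n ≥ N, ∀ w, (expMap lam)^[n] w = a → ‖w‖ ≤ C →
      M < ‖deriv (expMap lam)^[n] w‖ := by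
  by_contra! hcon
  choose n hn w hw hwC hwM using hcon
  obtain ⟨ρ, hρ, hPρ⟩ := exists_norm_bound hb
  obtain ⟨k, hk⟩ := exists_period_norm_gt ρ
  -- A translate of 0 by a long period: it lies off P while its image f(0) lies in P, so all of its
  -- proper forward orbit is in P.
  set b : ℂ := k * (2 * Real.pi * Complex.I) with hbdef
  have hbP : b ∉ postOrbit lam := fun h => (hPρ b h).not_gt hk
  have hfb : expMap lam b ∈ postOrbit lam := by
    have h1 := expMap_add_int_mul lam 0 k
    rw [zero_add] at h1
    rw [hbdef, h1]
    exact iterate_zero_mem_postOrbit lam 1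
  obtain ⟨s, hs, hsd⟩ := exists_ball_disjoint_postOrbit hbP
  obtain ⟨K, hK, hcomp⟩ := pullbackComparable_of_isPreconnected hlam hconn ha hbP
  choose w' hw' hdist hder using fun N => hcomp a rfl (n N) (w N) (hw N)
  set M' := K * max M 1 with hM'
  have hM'0 : 0 < M' := by positivity
  have hderM : ∀ N, ‖deriv (expMap lam)^[n N] (w' N)‖ ≤ M' := fun N =>
    (hder N).trans (by rw [hM']; gcongr; exact (hwM N).trans (le_max_left _ _))
  -- The shift to N + 1 ensures at least one iterate, as the lower derivative bound requires.
  have hbdd : ∀ N, w' (N + 1) ∈ closedBall (0 : ℂ) (C + K / (2 * s / 2000)) := by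
    intro N
    have h1 := le_norm_deriv_iterate hlam (by positivity) hsd
      (show 1 ≤ n (N + 1) from le_trans (by lia) (hn (N + 1))) (hw' (N + 1))
    rw [mem_closedBall_zero_iff]
    have h2 : ‖w' (N + 1) - w (N + 1)‖ ≤ K / (2 * s / 2000) := by
      rw [le_div_iff₀ (by positivity)]
      exact le_trans (by gcongr) (hdist (N + 1))
    have h3 := norm_le_norm_add_norm_sub' (w' (N + 1)) (w (N + 1))
    linarith [hwC (N + 1)]
  obtain ⟨q, -, θ, hθ, hlim⟩ := tendsto_subseq_of_bounded isBounded_closedBall hbdd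
  -- Bounded derivatives make the pullback of the s-disc about b contain a disc of this radius about
  -- each `w'`.
  set η := s / (2000 * M') with hη
  have hη0 : 0 < η := by positivity
  have hev : ∀ᶠ i in atTop, dist (w' (θ i + 1)) q < η / 2 :=
    (Metric.tendsto_nhds.1 hlim) _ (by positivity)
  obtain ⟨i, hi⟩ := hev.exists
  obtain ⟨j, hj, hji⟩ := (hev.and (eventually_gt_atTop (n (θ i + 1)))).exists
  have hlt : n (θ i + 1) < n (θ j + 1) :=
    lt_of_lt_of_le (hji.trans_le (hθ.le_apply.trans (Nat.le_succ _))) (hn _)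
  obtain ⟨φ, hφ, hφb⟩ := exists_inverseBranch hlam
    (hsd.mono_left (ball_subset_ball (by linarith : s ≤ 2 * s))) _ (mem_ball_self hs)
    (hw' (θ j + 1))
  have hcov := ball_subset_image_ball_of_injOn hs hφ.diff hφ.injOn
  have hrad : η ≤ ‖deriv φ b‖ * s / 2000 := by
    have h1 := hφ.norm_deriv_mul (differentiable_iterate lam _) (mem_ball_self hs)
    rw [hφb] at h1
    have h2 : 1 ≤ M' * ‖deriv φ b‖ := by
      rw [← h1]
      gcongr
      exact hderM _
    rw [hη, div_le_div_iff₀ (by positivity) (by norm_num)]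
    nlinarith
  have hmem : w' (θ i + 1) ∈ ball (φ b) (‖deriv φ b‖ * s / 2000) := by
    rw [mem_ball, hφb]
    have := dist_triangle_right (w' (θ i + 1)) (w' (θ j + 1)) q
    linarith
  obtain ⟨y, hy, hye⟩ := hcov hmem
  have h1 := hφ.right_inv y hy
  -- The earlier preimage lies in the pullback belonging to the later time, so a proper forward
  -- iterate of b falls into the disc about b, which misses P.
  obtain ⟨m, hm⟩ := Nat.exists_eq_add_of_lt hlt
  rw [hye, show n (θ j + 1) = (m + 1) + n (θ i + 1) by lia, Function.iterate_add_apply, hw',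
    Function.iterate_succ_apply] at h1
  exact disjoint_left.1 hsd (ball_subset_ball (by linarith) hy)
    (h1 ▸ iterate_mem_postOrbit hfb m)

/-! ### Density points -/

/-- Images under contracting inverse branches, close to a density point of `A`, of sets with measure
bounded below have to meet `A`. -/
lemma exists_image_inter_nonempty {A : Set ℂ} (hA : MeasurableSet A) {z : ℂ}
    (hz : Tendsto (fun r => volume (A ∩ closedBall z r) / volume (closedBall z r)) (𝓝[>] 0) (𝓝 1))
    {κ D c : ℝ} (hκ : 0 ≤ κ) (hD : 0 < D) (hc : 0 < c) :
    ∃ ε > 0, ∀ F φ : ℂ → ℂ, ∀ w, Differentiable ℂ F → IsInverseBranch F φ w (2 * D) →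
      ‖φ w - z‖ ≤ κ * ‖deriv φ w‖ → ‖deriv φ w‖ < ε → ∀ G ⊆ ball w D, MeasurableSet G →
      c ≤ volume.real G → (φ '' G ∩ A).Nonempty := by
  have hK := distortionConst_pos
  set κ' := κ + distortionConst * D with hκ'
  have hκ'0 : 0 < κ' := by positivity
  -- The least proportion of the disc of radius κ'δ about z, with δ = |φ'(w)|, that φ(G) can occupy;
  -- κ' makes this disc contain the image.
  set q := c / (distortionConst ^ 2 * κ' ^ 2 * Real.pi) with hq
  have hpi := Real.pi_pos
  have hq0 : 0 < q := by positivity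
  have hreal : Tendsto (fun r => volume.real (A ∩ closedBall z r) / volume.real (closedBall z r))
      (𝓝[>] 0) (𝓝 1) := by
    have := (ENNReal.tendsto_toReal ENNReal.one_ne_top).comp hz
    simpa [Function.comp_def, ENNReal.toReal_div, Measure.real] using this
  have hev := hreal.eventually (lt_mem_nhds (show 1 - q < 1 by linarith))
  obtain ⟨ε, hε, hball⟩ := Metric.mem_nhdsWithin_iff.1 hev
  refine ⟨ε / κ', by positivity, fun F φ w hF hφ hφz hφε G hG hGm hcG => ?_⟩
  set δ := ‖deriv φ w‖ with hδ
  have hww : w ∈ ball w (2 * D) := mem_ball_self (by positivity)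
  have hδ0 : 0 < δ := norm_pos_iff.2 (hφ.deriv_ne_zero hF hww)
  have hsub : ball w D ⊆ ball w (2 * D) := ball_subset_ball (by linarith)
  have hhalf : ball w D = ball w (2 * D / 2) := by congr 1; ring
  set ρ := κ' * δ with hρ
  have hρ0 : 0 < ρ := by positivity
  have hρε : ρ < ε := by rwa [hρ, mul_comm, ← lt_div_iff₀ hκ'0]
  have hX : 1 - q < volume.real (A ∩ closedBall z ρ) / volume.real (closedBall z ρ) :=
    hball ⟨by rwa [mem_ball, dist_zero_right, Real.norm_of_nonneg hρ0.le], hρ0⟩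
  by_contra hne
  rw [not_nonempty_iff_eq_empty, ← disjoint_iff_inter_eq_empty] at hne
  have himg : φ '' G ⊆ closedBall z ρ := by
    rintro _ ⟨x, hx, rfl⟩
    have hx' := hG hx
    have h1 := hφ.norm_sub_le_mul hF (hhalf ▸ hx') (hhalf ▸ mem_ball_self hD)
      (hhalf ▸ mem_ball_self hD)
    have h2 : ‖x - w‖ ≤ D := by rw [← dist_eq_norm]; exact (mem_ball.1 hx').le
    rw [mem_closedBall, dist_eq_norm]
    calc ‖φ x - z‖ ≤ ‖φ x - φ w‖ + ‖φ w - z‖ := norm_sub_le_norm_sub_add_norm_sub _ _ _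
      _ ≤ distortionConst * δ * ‖x - w‖ + κ * δ := add_le_add h1 hφz
      _ ≤ distortionConst * δ * D + κ * δ := by gcongr
      _ = ρ := by rw [hρ, hκ']; ring
  have hvol : c * (δ / distortionConst) ^ 2 ≤ volume.real (φ '' G) := by
    have h1 : volume (φ '' G) = ∫⁻ x in G, ENNReal.ofReal (‖deriv φ x‖ ^ 2) := by
      have := lintegral_image_of_hasDerivAt hGm (fun x hx => hφ.hasDerivAt (hsub (hG hx)))
        (hφ.injOn.mono (hG.trans hsub)) (fun _ => 1)
      simpa using this
    have h2 : ENNReal.ofReal ((δ / distortionConst) ^ 2) * volume G ≤ volume (φ '' G) := by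
      rw [h1, ← setLIntegral_const]
      refine setLIntegral_mono' hGm fun x hx => ENNReal.ofReal_le_ofReal ?_
      refine pow_le_pow_left₀ (by positivity) ?_ 2
      rw [div_le_iff₀ hK, mul_comm]
      exact hφ.norm_deriv_le hF (hhalf ▸ mem_ball_self hD) (hhalf ▸ hG hx)
    have h3 := ENNReal.toReal_mono
      ((measure_mono himg).trans_lt measure_closedBall_lt_top).ne h2
    rw [ENNReal.toReal_mul, ENNReal.toReal_ofReal (by positivity)] at h3
    calc c * (δ / distortionConst) ^ 2 ≤ volume.real G * (δ / distortionConst) ^ 2 := by gcongr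
      _ = (δ / distortionConst) ^ 2 * volume.real G := mul_comm _ _
      _ ≤ _ := h3
  have hY : volume.real (closedBall z ρ) = Real.pi * ρ ^ 2 := by
    rw [Measure.real, Complex.volume_closedBall, ENNReal.toReal_mul, ENNReal.toReal_pow,
      ENNReal.toReal_ofReal hρ0.le, mul_comm]
    rfl
  have hadd : volume.real (A ∩ closedBall z ρ) + volume.real (φ '' G) ≤
      volume.real (closedBall z ρ) := by
    rw [← measureReal_union' (hne.symm.mono_left inter_subset_left)
      (hA.inter measurableSet_closedBall)
      (measure_mono inter_subset_right |>.trans_lt measure_closedBall_lt_top).ne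
      (measure_mono himg |>.trans_lt measure_closedBall_lt_top).ne]
    exact measureReal_mono (union_subset inter_subset_right himg) measure_closedBall_lt_top.ne
  have hY0 : 0 < Real.pi * ρ ^ 2 := by positivity
  have hqY : q * (Real.pi * ρ ^ 2) = c * (δ / distortionConst) ^ 2 := by
    rw [hq, hρ]; field_simp
  rw [hY, lt_div_iff₀ hY0, sub_mul, one_mul, hqY] at hX
  rw [hY] at hadd
  linarith

/-- A recurrent set of positive measure has full measure outside the post-singular set. -/
lemma volume_compl_diff_recurrentSet (hlam : lam ≠ 0)
    (hb : Bornology.IsBounded (forwardOrbit (expMap lam) 0))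
    (hconn : IsPreconnected (postOrbit lam)ᶜ) {a : ℂ} {r : ℝ} (hr : 0 < r)
    (hd : Disjoint (ball a (2 * r)) (postOrbit lam))
    (hE : 0 < volume (recurrentSet lam (ball a r))) :
    volume ((postOrbit lam)ᶜ \ recurrentSet lam (ball a r)) = 0 := by
  set E := recurrentSet lam (ball a r) with hEdef
  have hEm : MeasurableSet E := measurableSet_recurrentSet lam measurableSet_ball
  refine measure_null_of_locally_null _ fun b hbs => ?_
  have hbP : b ∉ postOrbit lam := hbs.1
  have haP : a ∉ postOrbit lam := disjoint_left.1 hd (mem_ball_self (by positivity))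
  obtain ⟨s, hs, hsd⟩ := exists_ball_disjoint_postOrbit hbP
  refine ⟨ball b s \ E, ?_, ?_⟩
  · refine mem_nhdsWithin.2 ⟨ball b s, isOpen_ball, mem_ball_self hs, ?_⟩
    exact fun x hx => ⟨hx.1, hx.2.2⟩
  by_contra hpos
  set c := volume.real (ball b s \ E) with hc
  have hc0 : 0 < c := ENNReal.toReal_pos hpos
    (measure_mono sdiff_subset |>.trans_lt measure_ball_lt_top).ne
  obtain ⟨z, hzE, hz⟩ : ∃ z ∈ E, Tendsto (fun r => volume (E ∩ closedBall z r) /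
      volume (closedBall z r)) (𝓝[>] 0) (𝓝 1) := by
    have h1 := Besicovitch.ae_tendsto_measure_inter_div volume E
    rw [ae_restrict_iff' hEm] at h1
    by_contra! hcon
    refine hE.ne' (measure_mono_null (fun z hz => ?_) h1)
    exact fun h => hcon z hz (h hz)
  obtain ⟨K, hK, hcomp⟩ := (pullbackComparable_ball hlam hr hd (mem_ball_self hr)).trans
    (pullbackComparable_of_isPreconnected hlam hconn haP hbP)
  obtain ⟨ε, hε, hdens⟩ := exists_image_inter_nonempty hEm hz hK.le hs hc0
  -- Returns of the density point z to the disc about a yield nearby preimages of b. The inverse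
  -- branches there contract towards z, so they must carry a point of `ball b s \ E` into E, against
  -- complete invariance.
  obtain ⟨N, hN⟩ := exists_lt_norm_deriv_iterate hlam hb hconn hbP (1 / ε)
    (‖z‖ + K / (2 * s / 2000))
  obtain ⟨n, hn, hnB⟩ := (frequently_atTop.1 hzE) (max N 1)
  obtain ⟨w, hw, hwd, -⟩ := hcomp _ hnB n z rfl
  have hlow := le_norm_deriv_iterate hlam (by positivity) hsd (le_trans (le_max_right _ _) hn) hw
  have hdpos : 0 < ‖deriv (expMap lam)^[n] w‖ := lt_of_lt_of_le (by positivity) hlow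
  have hwz : ‖w - z‖ ≤ K / (2 * s / 2000) := by
    rw [le_div_iff₀ (by positivity)]
    exact le_trans (by gcongr) hwd
  have hbig := hN n (le_trans (le_max_left _ _) hn) w hw (by
    have := norm_le_norm_add_norm_sub' w z
    linarith)
  have hbb : b ∈ ball b (2 * s) := mem_ball_self (by positivity)
  obtain ⟨φ, hφ, rfl⟩ := exists_inverseBranch hlam hsd n hbb hw
  have hinv := hφ.norm_deriv_mul (differentiable_iterate lam n) hbb
  have hinv' : ‖deriv φ b‖ = 1 / ‖deriv (expMap lam)^[n] (φ b)‖ := by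
    rw [eq_div_iff hdpos.ne', mul_comm]; exact hinv
  obtain ⟨_, ⟨y, hy, rfl⟩, hyE⟩ := hdens _ φ b (differentiable_iterate lam n) hφ
    (by rw [hinv', mul_one_div, le_div_iff₀ hdpos]; exact hwd)
    (by rw [hinv', div_lt_comm₀ hdpos hε]; exact hbig)
    (ball b s \ E) sdiff_subset (measurableSet_ball.diff hEm) le_rfl
  have h1 := (iterate_mem_recurrentSet_iff n).2 hyE
  rw [hφ.right_inv y (ball_subset_ball (by linarith) hy.1)] at h1
  exact hy.2 h1

/-- Translated by a long period, P becomes disjoint from itself but is still mapped into P. The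
translate avoids both P and the recurrent set, so it lies in a null set. -/
lemma volume_postOrbit_eq_zero (hlam : lam ≠ 0)
    (hb : Bornology.IsBounded (forwardOrbit (expMap lam) 0))
    (hconn : IsPreconnected (postOrbit lam)ᶜ) {a : ℂ} {r : ℝ} (hr : 0 < r)
    (hd : Disjoint (ball a (2 * r)) (postOrbit lam))
    (hE : 0 < volume (recurrentSet lam (ball a r))) : volume (postOrbit lam) = 0 := by
  obtain ⟨ρ, hρ, hPρ⟩ := exists_norm_bound hb
  obtain ⟨k, hk⟩ := exists_period_norm_gt (2 * ρ)
  have hEP : Disjoint (recurrentSet lam (ball a r)) (postOrbit lam) :=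
    disjoint_recurrentSet_postOrbit (hd.mono_left (ball_subset_ball (by linarith)))
  rw [← measure_preimage_add_right volume (k * (2 * Real.pi * Complex.I))]
  refine measure_mono_null (fun x hx => ?_)
    (volume_compl_diff_recurrentSet hlam hb hconn hr hd hE)
  have hx' : x + k * (2 * Real.pi * Complex.I) ∈ postOrbit lam := hx
  have hfx : expMap lam x ∈ postOrbit lam := by
    rw [← expMap_add_int_mul lam x k]; exact expMap_mem_postOrbit hx'
  refine ⟨fun hxP => ?_, fun hxE => ?_⟩
  · have h1 := norm_sub_le (x + k * (2 * Real.pi * Complex.I)) x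
    rw [add_sub_cancel_left] at h1
    linarith [hPρ _ hx', hPρ _ hxP]
  · rw [← preimage_recurrentSet] at hxE
    exact disjoint_left.1 hEP hxE hfx

/-! ### Connectedness of the complement of the post-singular set -/

/-- Iterates that are uniformly bounded on a disc form a normal family on a smaller disc. -/
lemma iteratesNormalOn_of_bounded {f : ℂ → ℂ} (hf : Differentiable ℂ f) {x : ℂ} {s C : ℝ}
    (hs : 0 < s) (hC : ∀ n, ∀ z ∈ closedBall x (2 * s), ‖f^[n] z‖ ≤ C) :
    IteratesNormalOn f (ball x s) := by
  classical
  intro n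
  have hC0 : 0 ≤ C := (norm_nonneg _).trans (hC 0 x (mem_closedBall_self (by positivity)))
  have hlip : ∀ m, ∀ y ∈ closedBall x s, ∀ z ∈ closedBall x s,
      ‖f^[m] z - f^[m] y‖ ≤ C / s * ‖z - y‖ := by
    intro m y hy z hz
    refine (convex_closedBall x s).norm_image_sub_le_of_norm_deriv_le
      (fun w _ => (hf.iterate m) w) (fun w hw => ?_) hy hz
    refine Complex.norm_deriv_le_of_forall_mem_sphere_norm_le hs (hf.iterate m).diffContOnCl
      fun u hu => hC m u (closedBall_subset_closedBall' ?_ (sphere_subset_closedBall hu))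
    rw [mem_closedBall] at hw
    linarith
  have : CompactSpace (closedBall x s) := isCompact_iff_compactSpace.1 (isCompact_closedBall x s)
  let F : ℕ → BoundedContinuousFunction (closedBall x s) ℂ := fun j =>
    BoundedContinuousFunction.mkOfCompact
      ⟨fun z => f^[n j] z, (hf.iterate (n j)).continuous.comp continuous_subtype_val⟩
  have hcomp : IsCompact (closure (range F)) := by
    refine BoundedContinuousFunction.arzela_ascoli (closedBall 0 C) (isCompact_closedBall 0 C)
      (range F) ?_ ?_
    · rintro _ z ⟨j, rfl⟩
      rw [mem_closedBall_zero_iff]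
      exact hC (n j) z (closedBall_subset_closedBall (by linarith) z.2)
    · refine Metric.equicontinuous_of_continuity_modulus (fun t => C / s * t) ?_ _ ?_
      · have : Tendsto (fun t : ℝ => C / s * t) (𝓝 0) (𝓝 (C / s * 0)) :=
          (continuous_const_mul _).tendsto 0
        rwa [mul_zero] at this
      · rintro y z ⟨_, j, rfl⟩
        rw [dist_eq_norm, Subtype.dist_eq, dist_eq_norm]
        exact hlip (n j) z z.2 y y.2
  obtain ⟨g, -, k, hk, hlim⟩ := hcomp.tendsto_subseq (x := F) fun j => subset_closure ⟨j, rfl⟩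
  refine ⟨k, hk, Or.inl ⟨fun z => if h : z ∈ closedBall x s then g ⟨z, h⟩ else 0, ?_⟩⟩
  rw [BoundedContinuousFunction.tendsto_iff_tendstoUniformly] at hlim
  refine (TendstoUniformlyOn.mono ?_ ball_subset_closedBall).tendstoLocallyUniformlyOn
  rw [Metric.tendstoUniformlyOn_iff]
  intro ε hε
  filter_upwards [Metric.tendstoUniformly_iff.1 hlim ε hε] with j hj z hz
  rw [dif_pos hz]
  exact hj ⟨z, hz⟩

lemma isPreconnected_lt_norm {ρ : ℝ} (hρ : 0 < ρ) : IsPreconnected {z : ℂ | ρ < ‖z‖} := by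
  have : {z : ℂ | ρ < ‖z‖} = Complex.exp '' {z | Real.log ρ < z.re} := by
    ext z
    constructor
    · intro hz
      have hz' : ρ < ‖z‖ := hz
      have h0 : z ≠ 0 := norm_pos_iff.1 (hρ.trans hz')
      refine ⟨Complex.log z, ?_, Complex.exp_log h0⟩
      change Real.log ρ < (Complex.log z).re
      rw [Complex.log_re]
      exact Real.log_lt_log hρ hz'
    · rintro ⟨w, hw, rfl⟩
      change ρ < ‖Complex.exp w‖
      rw [Complex.norm_exp]
      exact (Real.log_lt_iff_lt_exp hρ).1 hw
  rw [this]
  exact (convex_halfSpace_re_gt _).isPreconnected.image _ Complex.continuous_exp.continuousOn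

/-- A bounded component of the complement has its frontier in P, so the maximum principle bounds all
iterates there and makes it part of the Fatou set. Only the component containing a neighbourhood of
∞ is left. -/
lemma isPreconnected_compl_postOrbit (hJ : juliaSet (expMap lam) = univ)
    (hb : Bornology.IsBounded (forwardOrbit (expMap lam) 0)) :
    IsPreconnected (postOrbit lam)ᶜ := by
  obtain ⟨ρ, hρ, hPρ⟩ := exists_norm_bound hb
  set W : Set ℂ := {z | ρ < ‖z‖} with hW
  have hWP : W ⊆ (postOrbit lam)ᶜ := fun z hz hzP => (hPρ z hzP).not_gt hz
  have hx0 : ((ρ + 1 : ℝ) : ℂ) ∈ W := by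
    change ρ < ‖((ρ + 1 : ℝ) : ℂ)‖
    rw [Complex.norm_real, Real.norm_of_nonneg (by positivity)]
    linarith
  set x0 : ℂ := ((ρ + 1 : ℝ) : ℂ)
  have hopen : IsOpen (postOrbit lam)ᶜ := (isClosed_postOrbit lam).isOpen_compl
  suffices h : (postOrbit lam)ᶜ = connectedComponentIn (postOrbit lam)ᶜ x0 by
    rw [h]; exact isPreconnected_connectedComponentIn
  refine Subset.antisymm (fun x hx => ?_) (connectedComponentIn_subset _ _)
  by_contra hxc
  set V := connectedComponentIn (postOrbit lam)ᶜ x with hV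
  have hVo : IsOpen V := hopen.connectedComponentIn
  have hxV : x ∈ V := mem_connectedComponentIn hx
  have hVρ : ∀ z ∈ V, ‖z‖ ≤ ρ := by
    intro z hz
    by_contra! hlt
    have h1 := (isPreconnected_lt_norm hρ).subset_connectedComponentIn (x := z) hlt hWP
    have h2 : connectedComponentIn (postOrbit lam)ᶜ x = connectedComponentIn (postOrbit lam)ᶜ z :=
      connectedComponentIn_eq hz
    have h3 : connectedComponentIn (postOrbit lam)ᶜ z = connectedComponentIn (postOrbit lam)ᶜ x0 :=
      connectedComponentIn_eq (h1 hx0)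
    rw [← h3, ← h2] at hxc
    exact hxc hxV
  have hfr : frontier V ⊆ postOrbit lam := by
    intro y hy
    by_contra hyP
    have hyo : IsOpen (connectedComponentIn (postOrbit lam)ᶜ y) := hopen.connectedComponentIn
    obtain ⟨u, hu, huV⟩ := mem_closure_iff.1 (frontier_subset_closure hy) _ hyo
      (mem_connectedComponentIn hyP)
    have h1 : connectedComponentIn (postOrbit lam)ᶜ y = V :=
      (connectedComponentIn_eq hu).trans (connectedComponentIn_eq huV).symm
    exact disjoint_left.1 (disjoint_frontier_iff_isOpen.2 hVo) hy
      (h1 ▸ mem_connectedComponentIn hyP)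
  have hbd : ∀ n, ∀ z ∈ V, ‖(expMap lam)^[n] z‖ ≤ ρ := fun n z hz =>
    Complex.norm_le_of_forall_mem_frontier_norm_le
      (isBounded_closedBall.subset fun z hz => mem_closedBall_zero_iff.2 (hVρ z hz))
      (differentiable_iterate lam n).diffContOnCl
      (fun y hy => hPρ _ (iterate_mem_postOrbit (hfr hy) n)) (subset_closure hz)
  obtain ⟨ε, hε, hεV⟩ := Metric.isOpen_iff.1 hVo x hxV
  have hnorm : IteratesNormalOn (expMap lam) (ball x (ε / 4)) :=
    iteratesNormalOn_of_bounded (differentiable_expMap lam) (by positivity)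
      fun n z hz => hbd n z (hεV (closedBall_subset_ball (by linarith) hz))
  have hxJ : x ∈ juliaSet (expMap lam) := hJ ▸ mem_univ x
  exact hxJ ⟨_, isOpen_ball, mem_ball_self (by positivity), hnorm⟩

/-! ### Non-existence of invariant probabilities -/

/-- An absolutely continuous invariant probability forces the limit density to be integrable and
invariant. -/
lemma exists_limitDensity_invariant (hlam : lam ≠ 0) (hP : volume (postOrbit lam) = 0)
    {μ : Measure ℂ} [IsProbabilityMeasure μ] (hμ : IsACInvariant (expMap lam) μ) :
    ∃ a ∉ postOrbit lam, ∫⁻ z, limitDensity lam a z ≠ ⊤ ∧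
      transfer lam (limitDensity lam a) =ᵐ[volume] limitDensity lam a := by
  have hμP : μ (postOrbit lam) = 0 := hμ.ac hP
  have hμc : μ (postOrbit lam)ᶜ ≠ 0 := by
    rw [prob_compl_eq_one_iff (isClosed_postOrbit lam).measurableSet |>.2 hμP]
    exact one_ne_zero
  -- A point off P in the support of μ.
  obtain ⟨a, haP, ha⟩ : ∃ a ∈ (postOrbit lam)ᶜ, ∀ u ∈ 𝓝[(postOrbit lam)ᶜ] a, μ u ≠ 0 := by
    by_contra! hcon
    exact hμc (measure_null_of_locally_null _ hcon)
  obtain ⟨r, hr, hd⟩ := exists_ball_disjoint_postOrbit haP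
  have hB : μ (ball a r) ≠ 0 := ha _ (mem_nhdsWithin_of_mem_nhds (ball_mem_nhds a hr))
  set γ : Measure ℂ := volume.withDensity baseDensity with hγ
  have hγfin : IsFiniteMeasure γ := isFiniteMeasure_withDensity lintegral_baseDensity_lt_top.ne
  have hac : μ ≪ γ := hμ.ac.trans (withDensity_absolutelyContinuous'
    measurable_baseDensity.aemeasurable (Eventually.of_forall fun z => (baseDensity_pos z).ne'))
  have hint : ∫⁻ z, μ.rnDeriv γ z ∂γ ≠ ⊤ := (Measure.lintegral_rnDeriv_lt_top μ γ).ne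
  obtain ⟨δ, hδ, hsmall⟩ := exists_pos_setLIntegral_lt_of_measure_lt hint hB
  -- All these preimages have the same positive μ-measure, so absolute continuity keeps their mass
  -- for the base density away from 0.
  have hlow : ∀ k, δ ≤ ∫⁻ z in (expMap lam)^[k] ⁻¹' ball a r, baseDensity z := by
    intro k
    have hm := measurable_iterate lam k (measurableSet_ball (x := a) (ε := r))
    by_contra! hlt
    rw [← withDensity_apply _ hm] at hlt
    have h1 := hsmall _ hlt
    rw [Measure.setLIntegral_rnDeriv hac,
      (hμ.invariant.iterate k).measure_preimage measurableSet_ball.nullMeasurableSet] at h1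
    exact lt_irrefl _ h1
  have htop : ∑' k, ∫⁻ z in (expMap lam)^[k] ⁻¹' ball a r, baseDensity z = ⊤ := by
    rw [← top_le_iff, ← ENNReal.tsum_const_eq_top_of_ne_zero (α := ℕ) hδ.ne']
    exact ENNReal.tsum_le_tsum hlow
  have hlim := tendsto_densitySum hlam hr hd htop
  set c := oscConst r * volume (ball a r) with hc
  have hctop : c ≠ ⊤ := ENNReal.mul_ne_top (oscConst_ne_top r) measure_ball_lt_top.ne
  -- Linear growth of S_n(a) matches the total mass of S_n, which is exactly linear, so Fatou gives
  -- an integrable limit.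
  have hlin : ∀ n : ℕ, n * δ ≤ densitySum lam n a * c := by
    intro n
    refine le_trans ?_ (sum_setLIntegral_baseDensity_le hlam hr hd n)
    rw [← nsmul_eq_mul, ← Finset.card_range n, ← Finset.sum_const, Finset.card_range]
    exact Finset.sum_le_sum fun k _ => hlow k
  have hδtop : δ ≠ ⊤ := by
    refine ne_top_of_le_ne_top ?_ (hlow 0)
    exact ((setLIntegral_le_lintegral _ _).trans_lt lintegral_baseDensity_lt_top).ne
  have hmass : ∀ n, ∫⁻ x, densitySum lam n x = n * ∫⁻ z, baseDensity z := by
    intro n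
    simp only [densitySum_apply]
    rw [lintegral_finsetSum _ fun k _ => measurable_transfer_iterate measurable_baseDensity k]
    simp [lintegral_transfer_iterate hlam measurable_baseDensity]
  have hfin : ∫⁻ z, limitDensity lam a z ≠ ⊤ := by
    have hbound : ∫⁻ z, limitDensity lam a z ≤ (∫⁻ z, baseDensity z) * (c * δ⁻¹) := by
      refine (lintegral_liminf_le fun n => (measurable_densitySum n).mul_const _).trans ?_
      rw [← liminf_const (f := (atTop : Filter ℕ)) ((∫⁻ z, baseDensity z) * (c * δ⁻¹))]
      refine liminf_le_liminf ?_
      filter_upwards [eventually_ge_atTop 1] with n hn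
      obtain ⟨n, rfl⟩ := Nat.exists_eq_add_of_le' hn
      rw [lintegral_mul_const _ (measurable_densitySum _), hmass, mul_comm ((n + 1 : ℕ) : ENNReal),
        mul_assoc]
      refine mul_le_mul_right ?_ _
      rw [← div_eq_mul_inv, ← div_eq_mul_inv,
        ENNReal.div_le_iff (densitySum_succ_ne_zero n a) (densitySum_ne_top hlam haP _),
        ENNReal.mul_comm_div, mul_comm c, ← ENNReal.mul_div_right_comm,
        ENNReal.le_div_iff_mul_le (Or.inl hδ.ne') (Or.inl hδtop)]
      exact hlin (n + 1)
    refine ne_top_of_le_ne_top ?_ hbound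
    exact ENNReal.mul_ne_top lintegral_baseDensity_lt_top.ne
      (ENNReal.mul_ne_top hctop (ENNReal.inv_ne_top.2 hδ.ne'))
  have hle : transfer lam (limitDensity lam a) ≤ᵐ[volume] limitDensity lam a := by
    filter_upwards [compl_mem_ae_iff.2 hP] with x hx
    exact transfer_limitDensity_le hlam hlim hx
  have hvm := measurable_limitDensity lam a
  -- T preserves total mass; with finite mass, Tv ≤ v then forces equality almost everywhere.
  have heq : ∫⁻ x, transfer lam (limitDensity lam a) x = ∫⁻ x, limitDensity lam a x :=
    lintegral_transfer_iterate hlam hvm 1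
  exact ⟨a, haP, hfin, ae_eq_of_ae_le_of_lintegral_le hle (heq ▸ hfin) hvm.aemeasurable heq.ge⟩

/-- Harnack makes vanishing locally constant off P, and the value at a is 1. -/
lemma limitDensity_ne_zero (hlam : lam ≠ 0) (hconn : IsPreconnected (postOrbit lam)ᶜ) {a x : ℂ}
    (ha : a ∉ postOrbit lam) (hx : x ∉ postOrbit lam) : limitDensity lam a x ≠ 0 := by
  refine hconn.induction₂' (fun x y => limitDensity lam a x ≠ 0 → limitDensity lam a y ≠ 0)
    (fun x hx => ?_) (fun x y z _ _ _ h1 h2 h => h2 (h1 h)) ha hx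
    (by rw [limitDensity_self hlam ha]; exact one_ne_zero)
  obtain ⟨r, hr, hd⟩ := exists_ball_disjoint_postOrbit hx
  refine nhdsWithin_le_nhds ?_
  filter_upwards [ball_mem_nhds x hr] with y hy
  refine ⟨fun h1 h2 => h1 ?_, fun h1 h2 => h1 ?_⟩
  · have := limitDensity_le hlam a hd (mem_ball_self hr) hy
    rwa [h2, mul_zero, nonpos_iff_eq_zero] at this
  · have := limitDensity_le hlam a hd hy (mem_ball_self hr)
    rwa [h2, mul_zero, nonpos_iff_eq_zero] at this

/-! ### Mass of far half-planes -/

lemma exists_rotation_lt_re {w : ℂ} {t : ℝ} (ht : 0 < t) (hw : 2 * t < ‖w‖) :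
    t < w.re ∨ t < (w * Complex.I).re ∨ t < (w * -1).re ∨ t < (w * -Complex.I).re := by
  by_contra! h
  simp only [Complex.mul_I_re, mul_neg, mul_one, Complex.neg_re] at h
  obtain ⟨h1, h2, h3, h4⟩ := h
  have h5 : ‖w‖ ^ 2 = w.re ^ 2 + w.im ^ 2 := by
    rw [← Complex.normSq_eq_norm_sq, Complex.normSq_apply]; ring
  nlinarith

/-- The four quarter-period translations. -/
noncomputable def quarterPeriod : Fin 4 → ℂ :=
  ![0, (Real.pi / 2 : ℝ) * Complex.I, Real.pi * Complex.I, (-(Real.pi / 2) : ℝ) * Complex.I]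

lemma norm_quarterPeriod_lt (j : Fin 4) : ‖quarterPeriod j‖ < 5 := by
  have h1 := Real.pi_lt_d2
  have h2 := Real.pi_pos
  fin_cases j
  · simp [quarterPeriod]
  · change ‖((Real.pi / 2 : ℝ) : ℂ) * Complex.I‖ < 5
    rw [norm_mul, Complex.norm_real, Complex.norm_I, mul_one, Real.norm_of_nonneg (by positivity)]
    linarith
  · change ‖(Real.pi : ℂ) * Complex.I‖ < 5
    rw [norm_mul, Complex.norm_real, Complex.norm_I, mul_one, Real.norm_of_nonneg (by positivity)]
    linarith
  · change ‖((-(Real.pi / 2) : ℝ) : ℂ) * Complex.I‖ < 5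
    rw [norm_mul, Complex.norm_real, Complex.norm_I, mul_one, norm_neg,
      Real.norm_of_nonneg (by positivity)]
    linarith

/-- The four translations multiply the image by 1, i, -1 and -i, and one of these rotations brings
it into the right half-plane with a definite share of its modulus. -/
lemma exists_quarterPeriod_lt_re (lam : ℂ) {z : ℂ} {t : ℝ} (ht : 0 < t)
    (hz : 2 * t < ‖expMap lam z‖) : ∃ j, t < (expMap lam (z + quarterPeriod j)).re := by
  have h0 : ∀ j, expMap lam (z + quarterPeriod j) =
      expMap lam z * Complex.exp (quarterPeriod j) := fun j => by
    rw [expMap, expMap, Complex.exp_add, mul_assoc]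
  have e1 : Complex.exp ((Real.pi / 2 : ℝ) * Complex.I) = Complex.I := by
    push_cast; exact Complex.exp_pi_div_two_mul_I
  have e3 : Complex.exp ((-(Real.pi / 2) : ℝ) * Complex.I) = -Complex.I := by
    push_cast; rw [neg_mul, Complex.exp_neg, Complex.exp_pi_div_two_mul_I, Complex.inv_I]
  rcases exists_rotation_lt_re ht hz with h | h | h | h
  · exact ⟨0, by simpa [h0, quarterPeriod] using h⟩
  · refine ⟨1, ?_⟩
    rw [h0]
    change t < (expMap lam z * Complex.exp ((Real.pi / 2 : ℝ) * Complex.I)).re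
    rwa [e1]
  · refine ⟨2, ?_⟩
    rw [h0]
    change t < (expMap lam z * Complex.exp (Real.pi * Complex.I)).re
    rwa [Complex.exp_pi_mul_I]
  · refine ⟨3, ?_⟩
    rw [h0]
    change t < (expMap lam z * Complex.exp ((-(Real.pi / 2) : ℝ) * Complex.I)).re
    rwa [e3]

lemma exists_quarterPeriod_re_lt (lam : ℂ) {z : ℂ} {t : ℝ} (ht : 0 < t)
    (hz : 2 * t < ‖expMap lam z‖) : ∃ j, (expMap lam (z + quarterPeriod j)).re < -t := by
  obtain ⟨j, hj⟩ := exists_quarterPeriod_lt_re (-lam) ht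
    (show 2 * t < ‖expMap (-lam) z‖ by rwa [norm_expMap, norm_neg, ← norm_expMap])
  refine ⟨j, ?_⟩
  simp only [expMap, neg_mul, Complex.neg_re] at hj ⊢
  linarith

/-- A set that meets every quarter-period orbit in a far right half-plane carries a definite part of
the mass of this half-plane. -/
lemma setLIntegral_le_of_quarterPeriod (hlam : lam ≠ 0) (a : ℂ) {ρ s : ℝ}
    (hPρ : ∀ z ∈ postOrbit lam, ‖z‖ ≤ ρ) (hs : ρ + 10 ≤ s) {G : Set ℂ} (hG : MeasurableSet G)
    (hGs : ∀ z, s < z.re → ∃ j, z + quarterPeriod j ∈ G) :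
    ∫⁻ z in {z : ℂ | s < z.re}, limitDensity lam a z ≤
      4 * oscConst 5 * ∫⁻ z in G, limitDensity lam a z := by
  have hsm : MeasurableSet {z : ℂ | s < z.re} := measurableSet_lt measurable_const
    Complex.measurable_re
  have hvm := measurable_limitDensity lam a
  have hpart : ∀ j, ∫⁻ z in {z : ℂ | s < z.re} ∩ (fun z => z + quarterPeriod j) ⁻¹' G,
      limitDensity lam a z ≤ oscConst 5 * ∫⁻ z in G, limitDensity lam a z := by
    intro j
    have hm : MeasurableSet ((fun z => z + quarterPeriod j) ⁻¹' G) :=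
      (measurable_id.add_const _) hG
    calc ∫⁻ z in {z : ℂ | s < z.re} ∩ (fun z => z + quarterPeriod j) ⁻¹' G, limitDensity lam a z
        ≤ ∫⁻ z in {z : ℂ | s < z.re} ∩ (fun z => z + quarterPeriod j) ⁻¹' G,
            oscConst 5 * limitDensity lam a (z + quarterPeriod j) := by
          refine setLIntegral_mono' (hsm.inter hm) fun z hz => ?_
          have hz1 : s < z.re := hz.1
          -- Harnack with r = 5, which exceeds every quarter period; Re z > ρ + 10 keeps the doubled
          -- disc off P.
          refine limitDensity_le hlam a (b := z) ?_ (mem_ball_self (by norm_num)) ?_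
          · refine disjoint_left.2 fun y hy hyP => ?_
            rw [mem_ball, dist_eq_norm] at hy
            have h1 := Complex.re_le_norm z
            have h2 := norm_le_norm_add_norm_sub' z y
            rw [norm_sub_rev] at h2
            linarith [hPρ y hyP]
          · rw [mem_ball, dist_eq_norm, add_sub_cancel_left]
            exact norm_quarterPeriod_lt j
      _ ≤ ∫⁻ z in (fun z => z + quarterPeriod j) ⁻¹' G,
            oscConst 5 * limitDensity lam a (z + quarterPeriod j) :=
          lintegral_mono_set inter_subset_right
      _ = ∫⁻ z in G, oscConst 5 * limitDensity lam a z :=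
          (measurePreserving_add_right volume (quarterPeriod j)).setLIntegral_comp_preimage hG
            (hvm.const_mul _)
      _ = _ := lintegral_const_mul _ hvm
  calc ∫⁻ z in {z : ℂ | s < z.re}, limitDensity lam a z
      ≤ ∫⁻ z in ⋃ j, {z : ℂ | s < z.re} ∩ (fun z => z + quarterPeriod j) ⁻¹' G,
          limitDensity lam a z := lintegral_mono_set fun z hz => by
        obtain ⟨j, hj⟩ := hGs z hz
        exact mem_iUnion.2 ⟨j, hz, hj⟩
    _ ≤ ∑' j, ∫⁻ z in {z : ℂ | s < z.re} ∩ (fun z => z + quarterPeriod j) ⁻¹' G,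
          limitDensity lam a z := lintegral_iUnion_le _ _
    _ ≤ ∑' _ : Fin 4, oscConst 5 * ∫⁻ z in G, limitDensity lam a z := ENNReal.tsum_le_tsum hpart
    _ = _ := by rw [tsum_fintype, Finset.sum_const, Finset.card_fin, nsmul_eq_mul, mul_assoc]; rfl

/-- A decreasing function that loses only a constant factor from `log (2t/L)` to `t` decays more
slowly than `1/t`. -/
lemma exists_le_mul_of_log_le {α β : ℝ → ℝ} (hanti : Antitone α) (hpos : ∀ t, 0 < α t)
    {κ L t₀ : ℝ} (hκ : 0 < κ) (hL : 0 < L)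
    (hα : ∀ t ≥ t₀, α (Real.log (2 * t / L)) ≤ κ * α t)
    (hβ : ∀ t ≥ t₀, α (Real.log (2 * t / L)) ≤ κ * β t) :
    ∃ A > 0, ∃ T > 0, ∀ t ≥ T, A ≤ β t * t := by
  have hlog : Tendsto (fun t : ℝ => Real.log (2 * t / L) / t) atTop (𝓝 0) := by
    have h1 : Tendsto (fun t : ℝ => Real.log (2 / L) / t + Real.log t / t) atTop (𝓝 (0 + 0)) :=
      (tendsto_const_nhds.div_atTop tendsto_id).add Real.isLittleO_log_id_atTop.tendsto_div_nhds_zero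
    rw [add_zero] at h1
    refine h1.congr' ?_
    filter_upwards [eventually_gt_atTop 0] with t ht
    rw [mul_div_right_comm, Real.log_mul (by positivity) ht.ne', add_div]
  have hev : ∀ᶠ t : ℝ in atTop, 1 ≤ t ∧ t₀ ≤ t ∧ κ * Real.log (2 * t / L) ≤ t ∧
      Real.log (2 * t / L) ≤ t / 2 := by
    filter_upwards [eventually_ge_atTop 1, eventually_ge_atTop t₀,
      hlog.eventually (gt_mem_nhds (show 0 < min (1 / κ) (1 / 2) by positivity))] with t h1 h2 h3
    have ht : 0 < t := by linarith
    obtain ⟨h4, h5⟩ := lt_min_iff.1 h3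
    rw [div_lt_div_iff₀ ht (by positivity)] at h4 h5
    exact ⟨h1, h2, by linarith, by linarith⟩
  obtain ⟨T, hT⟩ := eventually_atTop.1 hev
  have hT1 : 1 ≤ T := (hT T le_rfl).1
  set T₂ := max T (κ * T) with hT₂
  have hT₂0 : 0 < T₂ := lt_of_lt_of_le (by linarith) (le_max_left _ _)
  set A := T * α T₂ with hA
  have hA0 : 0 < A := mul_pos (by linarith) (hpos _)
  have hbase : ∀ t ≤ T₂, A ≤ α t * max t T := by
    intro t ht
    rw [hA, mul_comm]
    exact mul_le_mul (hanti ht) (le_max_right _ _) (by linarith) (hpos t).le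
  have hκmax : ∀ t ≥ T₂, κ * max (Real.log (2 * t / L)) T ≤ t := by
    intro t ht
    have h1 := (hT t ((le_max_left _ _).trans ht)).2.2.1
    rw [mul_max_of_nonneg _ _ hκ.le]
    exact max_le h1 ((le_max_right _ _).trans ht)
  -- Induction over dyadic ranges: log(2t/L) ≤ t/2 falls into the previous range, and the factor κ
  -- lost is absorbed by κ log(2t/L) ≤ t.
  have hind : ∀ n : ℕ, ∀ t ≤ 2 ^ n * T₂, A ≤ α t * max t T := by
    intro n
    induction n with
    | zero => intro t ht; exact hbase t (by simpa using ht)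
    | succ n ih =>
      intro t ht
      rcases le_or_gt t T₂ with h | h
      · exact hbase t h
      have htT : T ≤ t := (le_max_left _ _).trans h.le
      obtain ⟨h1, h2, -, h4⟩ := hT t htT
      have h5 := ih (Real.log (2 * t / L)) (by rw [pow_succ] at ht; linarith)
      have h6 : 0 ≤ max (Real.log (2 * t / L)) T := le_trans (by linarith) (le_max_right _ _)
      calc A ≤ α (Real.log (2 * t / L)) * max (Real.log (2 * t / L)) T := h5
        _ ≤ κ * α t * max (Real.log (2 * t / L)) T := by gcongr; exact hα t h2
        _ = α t * (κ * max (Real.log (2 * t / L)) T) := by ring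
        _ ≤ α t * t := by gcongr; exacts [(hpos t).le, hκmax t h.le]
        _ ≤ α t * max t T := by gcongr; exacts [(hpos t).le, le_max_left _ _]
  refine ⟨A, hA0, T₂, hT₂0, fun t ht => ?_⟩
  have htT : T ≤ t := (le_max_left _ _).trans ht
  obtain ⟨h1, h2, -, -⟩ := hT t htT
  have h6 : 0 < max (Real.log (2 * t / L)) T := lt_of_lt_of_le (by linarith) (le_max_right _ _)
  obtain ⟨n, hn⟩ := pow_unbounded_of_one_lt (Real.log (2 * t / L) / T₂) one_lt_two
  have h5 := hind n (Real.log (2 * t / L)) (by rw [div_lt_iff₀ hT₂0] at hn; exact hn.le)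
  have h7 := hβ t h2
  have h8 : 0 ≤ β t := by
    have := (hpos (Real.log (2 * t / L))).trans_le h7
    exact (pos_of_mul_pos_right this hκ.le).le
  calc A ≤ α (Real.log (2 * t / L)) * max (Real.log (2 * t / L)) T := h5
    _ ≤ κ * β t * max (Real.log (2 * t / L)) T := by gcongr
    _ = β t * (κ * max (Real.log (2 * t / L)) T) := by ring
    _ ≤ β t * t := by gcongr; exact hκmax t ht

/-! ### Return times from the far left half-plane -/

/-- Points close to `0` follow the bounded orbit of `0` for a time proportional to the logarithm of
their distance to `0`. -/
lemma norm_iterate_le_of_norm_le {ρ Λ : ℝ} (hPρ : ∀ z ∈ postOrbit lam, ‖z‖ ≤ ρ)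
    (hΛ : ‖lam‖ * Real.exp (ρ + 1) ≤ Λ) (hΛ1 : 1 ≤ Λ) {w : ℂ} {j : ℕ} (hw : ‖w‖ * Λ ^ j ≤ 1)
    {i : ℕ} (hi : i ≤ j) : ‖(expMap lam)^[i] w‖ ≤ ρ + 1 := by
  have hclose : ∀ i ≤ j, ‖(expMap lam)^[i] w - (expMap lam)^[i] 0‖ ≤ ‖w‖ * Λ ^ i := by
    intro i
    induction i with
    | zero => simp
    | succ i ih =>
      intro hi
      have h1 := ih (by lia)
      have h2 : ‖w‖ * Λ ^ i ≤ 1 := le_trans (by gcongr; lia) hw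
      have h0 := hPρ _ (iterate_zero_mem_postOrbit lam i)
      have h3 : ‖(expMap lam)^[i] w‖ ≤ ρ + 1 := by
        have := norm_le_norm_add_norm_sub' ((expMap lam)^[i] w) ((expMap lam)^[i] 0)
        linarith
      have h4 := (convex_closedBall (0 : ℂ) (ρ + 1)).norm_image_sub_le_of_norm_hasDerivWithin_le
        (f := expMap lam) (C := Λ) (fun z _ => (hasDerivAt_expMap lam z).hasDerivWithinAt)
        (fun z hz => by
          rw [norm_expMap]
          refine le_trans ?_ hΛ
          gcongr
          exact (Complex.re_le_norm z).trans (mem_closedBall_zero_iff.1 hz))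
        (x := (expMap lam)^[i] 0) (y := (expMap lam)^[i] w)
        (mem_closedBall_zero_iff.2 (by linarith)) (mem_closedBall_zero_iff.2 h3)
      rw [Function.iterate_succ_apply', Function.iterate_succ_apply']
      calc _ ≤ Λ * ‖(expMap lam)^[i] w - (expMap lam)^[i] 0‖ := h4
        _ ≤ Λ * (‖w‖ * Λ ^ i) := by gcongr
        _ = ‖w‖ * Λ ^ (i + 1) := by ring
  have h1 := hclose i hi
  have h2 : ‖w‖ * Λ ^ i ≤ 1 := le_trans (by gcongr) hw
  have := norm_le_norm_add_norm_sub' ((expMap lam)^[i] w) ((expMap lam)^[i] 0)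
  linarith [hPρ _ (iterate_zero_mem_postOrbit lam i)]

/-- If the points of `A j ⊆ L` do not return to `L` during the next `j` steps, the masses of the
sets `A j` are summable. -/
lemma sum_measureReal_le {f : ℂ → ℂ} {ν : Measure ℂ} [IsFiniteMeasure ν]
    (hf : MeasurePreserving f ν ν) {A : ℕ → Set ℂ} {L : Set ℂ} (hA : ∀ j, MeasurableSet (A j))
    (hAL : ∀ j, A j ⊆ L) (hret : ∀ j, ∀ z ∈ A j, ∀ i, 1 ≤ i → i ≤ j → f^[i] z ∉ L) (N : ℕ) :
    ∑ j ∈ Finset.range N, ν.real (A j) ≤ ν.real univ := by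
  have h1 : ∀ j, ν.real (A j) = ν.real (f^[N - j] ⁻¹' A j) := fun j => by
    rw [Measure.real, Measure.real, (hf.iterate (N - j)).measure_preimage (hA j).nullMeasurableSet]
  simp only [h1]
  -- A common point would be in `A j` at time N - j and back in `L` only j - i ≤ j steps later.
  have hdisj : ∀ i < N, ∀ j < N, i < j → Disjoint (f^[N - i] ⁻¹' A i) (f^[N - j] ⁻¹' A j) := by
    intro i hi j hj hij
    refine disjoint_left.2 fun w hw1 hw2 => ?_
    have h2 : f^[N - i] w = f^[j - i] (f^[N - j] w) := by
      rw [← Function.iterate_add_apply]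
      congr 2
      lia
    refine hret j _ hw2 (j - i) (by lia) (by lia) ?_
    rw [← h2]
    exact hAL i hw1
  rw [← measureReal_biUnion_finset]
  · exact measureReal_mono (subset_univ _)
  · intro i hi j hj hij
    have hi' := Finset.mem_range.1 hi
    have hj' := Finset.mem_range.1 hj
    rcases lt_or_gt_of_ne hij with h | h
    · exact hdisj i hi' j hj' h
    · exact (hdisj j hj' i hi' h).symm
  · exact fun j _ => (hf.iterate (N - j)).measurable (hA j)

theorem not_exists_isACInvariant_probability (hlam : lam ≠ 0)
    (hb : Bornology.IsBounded (forwardOrbit (expMap lam) 0))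
    (hconn : IsPreconnected (postOrbit lam)ᶜ) (hP : volume (postOrbit lam) = 0) :
    ¬ ∃ μ : Measure ℂ, IsProbabilityMeasure μ ∧ IsACInvariant (expMap lam) μ := by
  rintro ⟨μ, hμp, hμ⟩
  obtain ⟨a, haP, hfin, hae⟩ := exists_limitDensity_invariant hlam hP hμ
  obtain ⟨ρ, hρ, hPρ⟩ := exists_norm_bound hb
  have hvm := measurable_limitDensity lam a
  set ν : Measure ℂ := volume.withDensity (limitDensity lam a) with hν
  have hνfin : IsFiniteMeasure ν := isFiniteMeasure_withDensity hfin
  have hinv : MeasurePreserving (expMap lam) ν ν := measurePreserving_withDensity hlam hvm hae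
  have hright : ∀ t : ℝ, MeasurableSet {z : ℂ | t < z.re} := fun t =>
    measurableSet_lt measurable_const Complex.measurable_re
  have hleft : ∀ t : ℝ, MeasurableSet {z : ℂ | z.re < -t} := fun t =>
    measurableSet_lt Complex.measurable_re measurable_const
  have hL : 0 < ‖lam‖ := norm_pos_iff.2 hlam
  set α : ℝ → ℝ := fun t => ν.real {z | t < z.re} with hα
  set β : ℝ → ℝ := fun t => ν.real {z | z.re < -t} with hβ
  set κ : ℝ := (4 * oscConst 5).toReal + 1 with hκ
  have hκtop : 4 * oscConst 5 ≠ ⊤ := ENNReal.mul_ne_top (by norm_num) (oscConst_ne_top 5)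
  have hκ0 : 0 < κ := by positivity
  -- The quarter-period estimate is applied to the preimage of U, whose ν-mass is that of U by
  -- invariance. With U a right or a left half-plane it yields the two decay hypotheses.
  have hcompare : ∀ s ≥ ρ + 10, ∀ U : Set ℂ, MeasurableSet U →
      (∀ z : ℂ, s < z.re → ∃ j, expMap lam (z + quarterPeriod j) ∈ U) →
      α s ≤ κ * ν.real U := by
    intro s hs U hU hUs
    have h1 := setLIntegral_le_of_quarterPeriod hlam a hPρ hs (measurable_expMap lam hU) hUs
    rw [← withDensity_apply _ (hright s), ← withDensity_apply _ (measurable_expMap lam hU),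
      ← hν, hinv.measure_preimage hU.nullMeasurableSet] at h1
    have h2 := ENNReal.toReal_mono (ENNReal.mul_ne_top hκtop (measure_ne_top ν U)) h1
    rw [ENNReal.toReal_mul] at h2
    refine h2.trans ?_
    rw [hκ]
    exact mul_le_mul_of_nonneg_right (by linarith) measureReal_nonneg
  set t₀ : ℝ := ‖lam‖ / 2 * Real.exp (ρ + 10) with ht₀
  have ht₀0 : 0 < t₀ := by positivity
  have hs : ∀ t ≥ t₀, ρ + 10 ≤ Real.log (2 * t / ‖lam‖) := by
    intro t ht
    rw [Real.le_log_iff_exp_le (by have := ht₀0.trans_le ht; positivity), le_div_iff₀ hL]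
    rw [ht₀] at ht
    linarith
  have hexp : ∀ t ≥ t₀, ∀ z : ℂ, Real.log (2 * t / ‖lam‖) < z.re → 2 * t < ‖expMap lam z‖ := by
    intro t ht z hz
    rw [Real.log_lt_iff_lt_exp (by have := ht₀0.trans_le ht; positivity), div_lt_iff₀ hL] at hz
    rw [norm_expMap]
    linarith
  obtain ⟨A, hA, T, hT, hlow⟩ := exists_le_mul_of_log_le (α := α) (β := β)
    (fun s t hst => measureReal_mono fun z (hz : t < z.re) => lt_of_le_of_lt hst hz)
    (fun t => by
      refine ENNReal.toReal_pos (fun h0 => ?_) (measure_ne_top _ _)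
      rw [withDensity_apply _ (hright t)] at h0
      refine (setLIntegral_pos_iff hvm).2 ?_ |>.ne' h0
      have hsub : {z : ℂ | max t ρ < z.re} ⊆
          Function.support (limitDensity lam a) ∩ {z | t < z.re} := by
        intro z hz
        have hz' : max t ρ < z.re := hz
        refine ⟨limitDensity_ne_zero hlam hconn haP fun hzP => ?_, (le_max_left _ _).trans_lt hz'⟩
        have := (le_max_right t ρ).trans_lt hz'
        linarith [hPρ z hzP, Complex.re_le_norm z]
      refine lt_of_lt_of_le (IsOpen.measure_pos volume ?_ ?_) (measure_mono hsub)
      · exact isOpen_lt continuous_const Complex.continuous_re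
      · exact ⟨((max t ρ + 1 : ℝ) : ℂ), by
          change max t ρ < (((max t ρ + 1 : ℝ) : ℂ)).re
          rw [Complex.ofReal_re]; linarith⟩) hκ0 hL
    (fun t ht => hcompare _ (hs t ht) _ (hright t) fun z hz =>
      exists_quarterPeriod_lt_re lam (ht₀0.trans_le ht) (hexp t ht z hz))
    (fun t ht => hcompare _ (hs t ht) _ (hleft t) fun z hz =>
      exists_quarterPeriod_re_lt lam (ht₀0.trans_le ht) (hexp t ht z hz))
  set Λ : ℝ := max (‖lam‖ * Real.exp (ρ + 1)) (Real.exp 1) with hΛ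
  have hΛ1 : 1 ≤ Λ := (Real.one_le_exp zero_le_one).trans (le_max_right _ _)
  have hΛ0 : 0 < Λ := by linarith
  set C : ℝ := Real.log Λ with hC
  have hC0 : 0 ≤ C := Real.log_nonneg hΛ1
  -- Three demands: the sets lie in `L`, the bound A/t is available on them, and |λ| ≤ exp(C'), so
  -- that |f(z)| Λ^j ≤ 1.
  set C' : ℝ := max (max (ρ + 1) T) ‖lam‖ with hC'
  have hC'0 : 0 < C' := lt_of_lt_of_le hL (le_max_right _ _)
  have hsum := sum_measureReal_le hinv (A := fun j : ℕ => {z : ℂ | z.re < -(C * j + C')})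
    (L := {z | z.re < -(ρ + 1)}) (fun j => hleft _) (fun j z hz => by
      have hz' : z.re < -(C * j + C') := hz
      have h1 : ρ + 1 ≤ C' := (le_max_left _ _).trans (le_max_left _ _)
      have h2 : 0 ≤ C * j := by positivity
      change z.re < -(ρ + 1)
      linarith) (fun j z hz i hi hij hmem => by
      have hz' : z.re < -(C * j + C') := hz
      have hmem' : ((expMap lam)^[i] z).re < -(ρ + 1) := hmem
      obtain ⟨i, rfl⟩ := Nat.exists_eq_add_of_le' hi
      have hsmall : ‖expMap lam z‖ * Λ ^ j ≤ 1 := by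
        have hΛj : Λ ^ j = Real.exp (C * j) := by
          rw [hC, mul_comm, Real.exp_nat_mul, Real.exp_log hΛ0]
        have hle : ‖lam‖ ≤ Real.exp C' :=
          (le_max_right _ _).trans ((by linarith : C' ≤ C' + 1).trans (Real.add_one_le_exp C'))
        rw [norm_expMap, hΛj]
        calc ‖lam‖ * Real.exp z.re * Real.exp (C * j)
            ≤ Real.exp C' * Real.exp (-(C * j + C')) * Real.exp (C * j) := by gcongr
          _ = 1 := by rw [← Real.exp_add, ← Real.exp_add]; ring_nf; exact Real.exp_zero
      have h1 := norm_iterate_le_of_norm_le hPρ (le_max_left _ _) hΛ1 hsmall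
        (show i ≤ j by lia)
      rw [Function.iterate_succ_apply] at hmem'
      have h2 := Complex.abs_re_le_norm ((expMap lam)^[i] (expMap lam z))
      have h3 := neg_le_of_abs_le (h2.trans h1)
      linarith)
  have hterm : ∀ j : ℕ, A / (C + C') * (1 / ((j : ℝ) + 1)) ≤ β (C * j + C') := by
    intro j
    have hpos : 0 < C * j + C' := by positivity
    have h1 := hlow (C * j + C') (by
      have h1 : T ≤ C' := (le_max_right _ _).trans (le_max_left _ _)
      have h2 : 0 ≤ C * j := by positivity
      linarith)
    rw [← div_le_iff₀ hpos] at h1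
    refine le_trans ?_ h1
    rw [div_mul_div_comm, mul_one]
    refine div_le_div_of_nonneg_left hA.le hpos ?_
    nlinarith [(Nat.cast_nonneg j : (0 : ℝ) ≤ j)]
  have hdiv := Real.tendsto_sum_range_one_div_nat_succ_atTop.const_mul_atTop
    (show 0 < A / (C + C') by positivity)
  obtain ⟨N, hN⟩ := (hdiv.eventually (eventually_gt_atTop (ν.real univ))).exists
  rw [Finset.mul_sum] at hN
  have := (Finset.sum_le_sum fun j (_ : j ∈ Finset.range N) => hterm j).trans (hsum N)
  linarith

/-! ### The escaping set -/

/-- A vertical shift by at most 2π rotates the image of w onto the negative axis; within distance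
1/2 the argument moves by less than π/2. -/
lemma exists_re_expMap_neg (lam w : ℂ) (hlam : lam ≠ 0) :
    ∃ y₀, ball y₀ (1 / 2) ⊆ ball w 8 ∧ ∀ y ∈ ball y₀ (1 / 2), (expMap lam y).re < 0 := by
  set θ : ℝ := Real.pi - (expMap lam w).arg with hθ
  have hpi := Real.pi_lt_d2
  have hθ0 : |θ| ≤ 2 * Real.pi := by
    have h1 := Complex.arg_le_pi (expMap lam w)
    have h2 := Complex.neg_pi_lt_arg (expMap lam w)
    rw [abs_le, hθ]
    constructor <;> linarith
  refine ⟨w + θ * Complex.I, ball_subset_ball' ?_, fun y hy => ?_⟩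
  · rw [dist_eq_norm, add_sub_cancel_left, norm_mul, Complex.norm_I, mul_one, Complex.norm_real,
      Real.norm_eq_abs]
    linarith
  · set h := y - (w + θ * Complex.I) with hh
    have hnorm : ‖h‖ < 1 / 2 := by rwa [mem_ball, dist_eq_norm] at hy
    have hy' : y = w + θ * Complex.I + h := by rw [hh]; ring
    have h1 : expMap lam w * Complex.exp (θ * Complex.I) = -(‖expMap lam w‖ : ℂ) := by
      nth_rewrite 1 [← Complex.norm_mul_exp_arg_mul_I (expMap lam w)]
      rw [mul_assoc, ← Complex.exp_add, hθ]
      push_cast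
      rw [show ((expMap lam w).arg : ℂ) * Complex.I +
        (Real.pi - ((expMap lam w).arg : ℂ)) * Complex.I = Real.pi * Complex.I by ring,
        Complex.exp_pi_mul_I, mul_neg_one]
    have h2 : expMap lam y = -(‖expMap lam w‖ : ℂ) * Complex.exp h := by
      rw [hy', ← h1, expMap, expMap, Complex.exp_add, Complex.exp_add]
      ring
    rw [h2, neg_mul, Complex.neg_re, Complex.re_ofReal_mul, Complex.exp_re, neg_lt_zero]
    have him : |h.im| < 1 / 2 := (Complex.abs_im_le_norm h).trans_lt hnorm
    have hcos : 0 < Real.cos h.im := by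
      rw [abs_lt] at him
      have := Real.pi_gt_three
      exact Real.cos_pos_of_mem_Ioo ⟨by linarith, by linarith⟩
    have := norm_pos_iff.2 (expMap_ne_zero hlam w)
    have := Real.exp_pos h.re
    positivity

lemma two_pow_le_norm_deriv_iterate {z : ℂ} (hz : ∀ n, 2 ≤ ((expMap lam)^[n] z).re) (n : ℕ) :
    2 ^ n ≤ ‖deriv (expMap lam)^[n] z‖ := by
  induction n with
  | zero => simp
  | succ n ih =>
    rw [deriv_iterate_succ, norm_mul, pow_succ, mul_comm, ← Function.iterate_succ_apply' (expMap lam)]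
    exact mul_le_mul ((hz (n + 1)).trans (Complex.re_le_norm _)) ih (by positivity) (norm_nonneg _)

/-- For a bounded singular orbit, almost no orbit stays in a far right half-plane. -/
lemma volume_forall_le_re_eq_zero (hlam : lam ≠ 0) {ρ R : ℝ}
    (hPρ : ∀ z ∈ postOrbit lam, ‖z‖ ≤ ρ) (hR : ρ + 20 ≤ R) (hR2 : 2 ≤ R) :
    volume {z : ℂ | ∀ n, R ≤ ((expMap lam)^[n] z).re} = 0 := by
  set E := {z : ℂ | ∀ n, R ≤ ((expMap lam)^[n] z).re} with hE
  have hEm : MeasurableSet E := by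
    have : E = ⋂ n, (expMap lam)^[n] ⁻¹' {z | R ≤ z.re} := by ext z; simp [hE]
    rw [this]
    exact MeasurableSet.iInter fun n => measurable_iterate lam n
      (measurableSet_le measurable_const Complex.measurable_re)
  by_contra hpos
  obtain ⟨z, hzE, hz⟩ : ∃ z ∈ E, Tendsto (fun r => volume (E ∩ closedBall z r) /
      volume (closedBall z r)) (𝓝[>] 0) (𝓝 1) := by
    have h1 := Besicovitch.ae_tendsto_measure_inter_div volume E
    rw [ae_restrict_iff' hEm] at h1
    by_contra! hcon
    refine hpos (measure_mono_null (fun z hz => ?_) h1)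
    exact fun h => hcon z hz (h hz)
  have hzn : ∀ n, R ≤ ((expMap lam)^[n] z).re := hzE
  have hc : 0 < volume.real (ball (0 : ℂ) (1 / 2)) :=
    ENNReal.toReal_pos (measure_ball_pos _ _ (by norm_num)).ne' measure_ball_lt_top.ne
  obtain ⟨ε, hε, hdens⟩ := exists_image_inter_nonempty hEm hz le_rfl
    (show (0 : ℝ) < 8 by norm_num) hc
  obtain ⟨n, hn⟩ := pow_unbounded_of_one_lt (1 / ε) one_lt_two
  have hder := two_pow_le_norm_deriv_iterate (fun n => hR2.trans (hzn n)) n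
  set w := (expMap lam)^[n] z with hw
  have hd : Disjoint (ball w (2 * 8)) (postOrbit lam) := by
    refine disjoint_left.2 fun y hy hyP => ?_
    rw [mem_ball, dist_eq_norm] at hy
    have h1 := Complex.re_le_norm w
    have h2 := norm_le_norm_add_norm_sub' w y
    rw [norm_sub_rev] at h2
    linarith [hPρ y hyP, hzn n]
  have hww : w ∈ ball w (2 * 8) := mem_ball_self (by norm_num)
  obtain ⟨φ, hφ, hφw⟩ := exists_inverseBranch hlam hd n hww hw.symm
  have hinv := hφ.norm_deriv_mul (differentiable_iterate lam n) hww
  rw [hφw] at hinv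
  obtain ⟨y₀, hy₀, hneg⟩ := exists_re_expMap_neg lam w hlam
  have hvol : volume.real (ball (0 : ℂ) (1 / 2)) ≤ volume.real (ball y₀ (1 / 2)) := by
    simp only [Measure.real, Complex.volume_ball, le_refl]
  -- The branch sends w back to the density point itself (κ = 0). The pulled-back disc must meet E,
  -- but one further iterate of its points has negative real part.
  obtain ⟨_, ⟨y, hy, rfl⟩, hyE⟩ := hdens _ φ w (differentiable_iterate lam n) hφ
    (by simp [hφw]) (by
      have h1 : 1 / ε < ‖deriv (expMap lam)^[n] z‖ := hn.trans_le hder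
      rw [div_lt_iff₀ hε] at h1
      have h2 : 0 < ‖deriv (expMap lam)^[n] z‖ := lt_of_lt_of_le (by positivity) hder
      by_contra! hge
      have := mul_le_mul_of_nonneg_left hge h2.le
      linarith) _ hy₀ measurableSet_ball hvol
  have h1 : R ≤ ((expMap lam)^[n + 1] (φ y)).re := hyE (n + 1)
  rw [Function.iterate_succ_apply', hφ.right_inv y (ball_subset_ball (by norm_num) (hy₀ hy))] at h1
  linarith [hneg y hy]

/-- As |f(z)| = |λ| exp(Re z), a large modulus forces a large real part one step earlier, so
escaping orbits eventually stay in a far right half-plane. -/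
lemma volume_escaping_eq_zero (hlam : lam ≠ 0)
    (hb : Bornology.IsBounded (forwardOrbit (expMap lam) 0)) :
    volume {z : ℂ | Tendsto (fun n => ‖(expMap lam)^[n] z‖) atTop atTop} = 0 := by
  obtain ⟨ρ, hρ, hPρ⟩ := exists_norm_bound hb
  set R := ρ + 20 with hR
  set E := {z : ℂ | ∀ n, R ≤ ((expMap lam)^[n] z).re} with hE
  have hEm : MeasurableSet E := by
    have : E = ⋂ n, (expMap lam)^[n] ⁻¹' {z | R ≤ z.re} := by ext z; simp [hE]
    rw [this]
    exact MeasurableSet.iInter fun n => measurable_iterate lam n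
      (measurableSet_le measurable_const Complex.measurable_re)
  have h0 := volume_forall_le_re_eq_zero hlam hPρ hR.ge (by linarith)
  refine measure_mono_null (fun z hz => ?_)
    (measure_iUnion_null fun N => volume_preimage_iterate_eq_zero hlam hEm h0 N)
  have hz' : Tendsto (fun n => ‖(expMap lam)^[n] z‖) atTop atTop := hz
  obtain ⟨N, hN⟩ := eventually_atTop.1
    (hz'.eventually (eventually_ge_atTop (‖lam‖ * Real.exp R)))
  refine mem_iUnion.2 ⟨N, fun n => ?_⟩
  have h1 := hN (n + N + 1) (by lia)
  rw [Function.iterate_succ_apply', norm_expMap] at h1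
  have h2 := le_of_mul_le_mul_left h1 (norm_pos_iff.2 hlam)
  rw [← Function.iterate_add_apply]
  exact Real.exp_le_exp.1 h2

/-! ### Normality and recurrence -/

/-- A point with a limit point outside the post-singular set is in the Julia set. -/
lemma mem_juliaSet_of_mapClusterPt (hlam : lam ≠ 0)
    (hb : Bornology.IsBounded (forwardOrbit (expMap lam) 0))
    (hconn : IsPreconnected (postOrbit lam)ᶜ) {x p : ℂ} (hp : p ∉ postOrbit lam)
    (hx : MapClusterPt p atTop fun n => (expMap lam)^[n] x) {U : Set ℂ} (hU : IsOpen U)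
    (hxU : x ∈ U) : ¬ IteratesNormalOn (expMap lam) U := by
  intro hnorm
  obtain ⟨r, hr, hd⟩ := exists_ball_disjoint_postOrbit hp
  obtain ⟨K, hK, hcomp⟩ := pullbackComparable_ball hlam hr hd (mem_ball_self hr)
  have hbig : ∀ M, ∃ N, ∀ n ≥ N, (expMap lam)^[n] x ∈ ball p r →
      M < ‖deriv (expMap lam)^[n] x‖ := by
    intro M
    obtain ⟨N, hN⟩ := exists_lt_norm_deriv_iterate hlam hb hconn hp (K * M)
      (‖x‖ + K / (2 * r / 2000))
    refine ⟨max N 1, fun n hn hnB => ?_⟩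
    obtain ⟨w, hw, hwd, hder⟩ := hcomp _ hnB n x rfl
    have hlow := le_norm_deriv_iterate hlam (by positivity) hd (le_trans (le_max_right _ _) hn) hw
    have hwx : ‖w - x‖ ≤ K / (2 * r / 2000) := by
      rw [le_div_iff₀ (by positivity)]
      exact le_trans (by gcongr) hwd
    have h1 := hN n (le_trans (le_max_left _ _) hn) w hw (by
      have := norm_le_norm_add_norm_sub' w x
      linarith)
    exact lt_of_mul_lt_mul_left (h1.trans_le hder) hK.le
  obtain ⟨n, hn, hnB⟩ := extraction_of_frequently_atTop
    (mapClusterPt_iff_frequently.1 hx _ (ball_mem_nhds p hr))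
  obtain ⟨k, hk, ⟨g, hg⟩ | hinf⟩ := hnorm n
  -- Locally uniform limits carry over to derivatives, which contradicts their blow-up at the return
  -- times; a limit ∞ contradicts the returns themselves.
  · have h1 := (hg.deriv (Eventually.of_forall fun j =>
      (differentiable_iterate lam (n (k j))).differentiableOn) hU).tendsto_at hxU
    have h2 := h1.norm.eventually (gt_mem_nhds (lt_add_one _))
    obtain ⟨N, hN⟩ := hbig (‖deriv g x‖ + 1)
    obtain ⟨j, hj, hjN⟩ := (h2.and (eventually_ge_atTop N)).exists
    have h3 := hN (n (k j)) (hjN.trans ((hk.le_apply).trans hn.le_apply)) (hnB _)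
    exact lt_asymm hj h3
  · obtain ⟨j, hj⟩ := (hinf {x} (singleton_subset_iff.2 hxU) isCompact_singleton
      (‖p‖ + r)).exists
    have h1 := hj x rfl
    have h2 := hnB (k j)
    rw [mem_ball, dist_eq_norm] at h2
    have := norm_le_norm_add_norm_sub' ((expMap lam)^[n (k j)] x) p
    linarith

/-! ### The parameter `2πi` -/

/-- The parameter `2πi`. -/
noncomputable def tau : ℂ := 2 * Real.pi * Complex.I

lemma norm_tau : ‖tau‖ = 2 * Real.pi := by simp [tau, abs_of_pos Real.pi_pos]

lemma tau_ne_zero : tau ≠ 0 := by simp [tau, Real.pi_ne_zero]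

lemma expMap_tau_zero : expMap tau 0 = tau := by simp [expMap]

lemma expMap_tau_tau : expMap tau tau = tau := by
  rw [expMap]
  nth_rewrite 2 [tau]
  rw [Complex.exp_two_pi_mul_I, mul_one]

lemma iterate_tau_zero (n : ℕ) : (expMap tau)^[n + 1] 0 = tau := by
  induction n with
  | zero => exact expMap_tau_zero
  | succ n ih => rw [Function.iterate_succ_apply', ih, expMap_tau_tau]

lemma forwardOrbit_tau : forwardOrbit (expMap tau) 0 = {0, tau} := by
  ext z
  constructor
  · rintro ⟨n, rfl⟩
    cases n with
    | zero => exact Or.inl rfl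
    | succ n => exact Or.inr (iterate_tau_zero n)
  · rintro (rfl | rfl)
    · exact ⟨0, rfl⟩
    · exact ⟨1, iterate_tau_zero 0⟩

lemma postOrbit_tau : postOrbit tau = {0, tau} := by
  rw [postOrbit, forwardOrbit_tau]
  exact (Set.toFinite _).isClosed.closure_eq

lemma isBounded_forwardOrbit_tau : Bornology.IsBounded (forwardOrbit (expMap tau) 0) := by
  rw [forwardOrbit_tau]
  exact (Set.toFinite _).isBounded

/-- Obtained directly from finiteness, because the general argument presupposes J = ℂ, which is
derived from this here. -/
lemma isPreconnected_compl_postOrbit_tau : IsPreconnected (postOrbit tau)ᶜ := by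
  rw [postOrbit_tau]
  exact ((Set.toFinite _).countable.isConnected_compl_of_one_lt_rank (by simp)).isPreconnected

lemma expMap_tau_sub (z : ℂ) : expMap tau z - tau = tau * (Complex.exp (z - tau) - 1) := by
  have : Complex.exp tau = 1 := Complex.exp_two_pi_mul_I
  rw [expMap, Complex.exp_sub, this]
  ring

/-- The fixed point `2πi` is repelling. -/
lemma norm_expMap_tau_sub {z : ℂ} (hz : ‖z - tau‖ ≤ 1 / 2) :
    3 * ‖z - tau‖ ≤ ‖expMap tau z - tau‖ ∧ ‖expMap tau z - tau‖ ≤ 5 := by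
  set h := z - tau
  have h1 := Complex.norm_exp_sub_one_sub_id_le (x := h) (by linarith)
  have h2 := norm_sub_norm_le h (h - (Complex.exp h - 1))
  rw [sub_sub_cancel, norm_sub_rev h] at h2
  have h3 := norm_add_le (Complex.exp h - 1 - h) h
  rw [sub_add_cancel] at h3
  have h4 := Real.pi_gt_three
  have h5 := Real.pi_lt_d2
  have h0 := norm_nonneg h
  have hsq : ‖h‖ ^ 2 ≤ ‖h‖ / 2 := by nlinarith
  rw [expMap_tau_sub, norm_mul, norm_tau]
  constructor
  · nlinarith
  · nlinarith

/-- An orbit of `2πi e^z` accumulating only on the post-singular set lands on `2πi` or escapes. -/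
lemma tendsto_norm_of_forall_not_mapClusterPt {z : ℂ}
    (hz : ∀ p ∉ postOrbit tau, ¬ MapClusterPt p atTop fun n => (expMap tau)^[n] z)
    (hland : ∀ n, (expMap tau)^[n] z ≠ tau) :
    Tendsto (fun n => ‖(expMap tau)^[n] z‖) atTop atTop := by
  by_contra hcon
  rw [Filter.tendsto_atTop] at hcon
  push Not at hcon
  obtain ⟨R, hR⟩ := hcon
  have hfreq : ∃ᶠ n in atTop, (expMap tau)^[n] z ∈ closedBall (0 : ℂ) R := by
    refine hR.mono fun n hn => ?_
    rw [mem_closedBall_zero_iff]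
    exact hn.le
  obtain ⟨p, -, hp⟩ := (isCompact_closedBall (0 : ℂ) R).exists_mapClusterPt_of_frequently hfreq
  have hpP : p ∈ postOrbit tau := by
    by_contra h
    exact hz p h hp
  have hnear : ∃ᶠ n in atTop, (expMap tau)^[n] z ∈ ball tau (1 / 2) := by
    rw [mapClusterPt_iff_frequently] at hp
    rw [postOrbit_tau] at hpP
    rcases hpP with rfl | rfl
    · have hc := (differentiable_expMap tau).continuous.continuousAt (x := 0)
      have h1 := hp _ (hc.preimage_mem_nhds
        (by rw [expMap_tau_zero]; exact ball_mem_nhds tau (show (0 : ℝ) < 1 / 2 by norm_num)))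
      rw [frequently_atTop] at h1 ⊢
      intro N
      obtain ⟨n, hn, hnB⟩ := h1 N
      refine ⟨n + 1, by lia, ?_⟩
      rw [Function.iterate_succ_apply']
      exact hnB
    · exact hp _ (ball_mem_nhds _ (by norm_num))
  -- Repulsion drives the orbit out of the small disc after each visit, and the first exit lands in
  -- this compact annulus. It contains neither 2πi nor 0, since 5 < 2π.
  have hann : ∃ᶠ n in atTop, (expMap tau)^[n] z ∈ closedBall tau 5 \ ball tau (1 / 2) := by
    rw [frequently_atTop] at hnear ⊢
    intro N
    obtain ⟨m, hm, hmB⟩ := hnear N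
    have hexit : ∃ k, (expMap tau)^[m + k] z ∉ ball tau (1 / 2) := by
      by_contra! hall
      have hgrow : ∀ k, 3 ^ k * ‖(expMap tau)^[m] z - tau‖ ≤ ‖(expMap tau)^[m + k] z - tau‖ := by
        intro k
        induction k with
        | zero => simp
        | succ k ih =>
          have h1 := (norm_expMap_tau_sub
            (by have := hall k; rw [mem_ball, dist_eq_norm] at this; exact this.le)).1
          rw [← Function.iterate_succ_apply' (expMap tau)] at h1
          rw [pow_succ]
          have : m + (k + 1) = (m + k).succ := rfl
          rw [this]
          linarith
      have hpos : 0 < ‖(expMap tau)^[m] z - tau‖ := norm_pos_iff.2 (sub_ne_zero.2 (hland m))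
      obtain ⟨k, hk⟩ := pow_unbounded_of_one_lt (1 / ‖(expMap tau)^[m] z - tau‖)
        (show (1 : ℝ) < 3 by norm_num)
      rw [div_lt_iff₀ hpos] at hk
      have h2 := hall k
      rw [mem_ball, dist_eq_norm] at h2
      linarith [hgrow k]
    classical
    have hspec := Nat.find_spec hexit
    have hmin := fun k => Nat.find_min hexit (m := k)
    set k := Nat.find hexit
    have hk0 : k ≠ 0 := fun h => hspec (by rw [h]; exact hmB)
    obtain ⟨l, hl⟩ := Nat.exists_eq_succ_of_ne_zero hk0
    refine ⟨m + k, by lia, ?_, hspec⟩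
    have hlB := not_not.1 (hmin l (by lia))
    rw [mem_ball, dist_eq_norm] at hlB
    have h1 := (norm_expMap_tau_sub hlB.le).2
    rw [← Function.iterate_succ_apply' (expMap tau)] at h1
    rw [mem_closedBall, dist_eq_norm, hl]
    exact h1
  obtain ⟨q, hqK, hq⟩ := ((isCompact_closedBall tau 5).diff
    isOpen_ball).exists_mapClusterPt_of_frequently hann
  refine hz q (fun hqP => ?_) hq
  rw [postOrbit_tau] at hqP
  rcases hqP with rfl | rfl
  · have h1 := hqK.1
    rw [mem_closedBall, dist_eq_norm, zero_sub, norm_neg, norm_tau] at h1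
    linarith [Real.pi_gt_three]
  · exact hqK.2 (mem_ball_self (by norm_num))

lemma volume_omegaLimitSet_subset_tau :
    volume {z : ℂ | omegaLimitSet (expMap tau) z ⊆ postSingularSet tau} = 0 := by
  refine measure_mono_null (t := (⋃ n, (expMap tau)^[n] ⁻¹' {tau}) ∪
    {z : ℂ | Tendsto (fun n => ‖(expMap tau)^[n] z‖) atTop atTop}) (fun z hz => ?_)
    (measure_union_null (measure_iUnion_null fun n => volume_preimage_iterate_eq_zero tau_ne_zero
      (measurableSet_singleton _) (measure_singleton _) n)
      (volume_escaping_eq_zero tau_ne_zero isBounded_forwardOrbit_tau))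
  by_cases hland : ∃ n, (expMap tau)^[n] z = tau
  · obtain ⟨n, hn⟩ := hland
    exact Or.inl (mem_iUnion.2 ⟨n, hn⟩)
  · refine Or.inr (tendsto_norm_of_forall_not_mapClusterPt (fun p hp hc => ?_)
      fun n hn => hland ⟨n, hn⟩)
    exact not_omegaLimitSet_subset_iff.2 ⟨p, hp, hc⟩ hz

/-- Almost every point has a cluster point off P, so every nonempty open set contains one, and the
iterates cannot be normal there. -/
theorem admissible_tau : Admissible tau where
  ne_zero := tau_ne_zero
  julia_eq := by
    refine eq_univ_of_forall fun z => ?_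
    rintro ⟨U, hU, hzU, hnorm⟩
    obtain ⟨x, hxU, hx⟩ : ∃ x ∈ U, ¬ omegaLimitSet (expMap tau) x ⊆ postSingularSet tau := by
      by_contra! hall
      exact (hU.measure_pos volume ⟨z, hzU⟩).ne'
        (measure_mono_null hall volume_omegaLimitSet_subset_tau)
    obtain ⟨p, hp, hc⟩ := not_omegaLimitSet_subset_iff.1 hx
    exact mem_juliaSet_of_mapClusterPt tau_ne_zero isBounded_forwardOrbit_tau
      isPreconnected_compl_postOrbit_tau hp hc hU hxU hnorm
  orbit_bounded := isBounded_forwardOrbit_tau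
  pos_measure := by
    rw [pos_iff_ne_zero]
    intro h0
    have h1 := measure_union_null h0 volume_omegaLimitSet_subset_tau
    have h2 : {z : ℂ | ¬ omegaLimitSet (expMap tau) z ⊆ postSingularSet tau} ∪
        {z : ℂ | omegaLimitSet (expMap tau) z ⊆ postSingularSet tau} = univ :=
      eq_univ_of_forall fun z => (em _).symm
    rw [h2] at h1
    exact (isOpen_univ.measure_pos volume ⟨(0 : ℂ), mem_univ _⟩).ne' h1

end ExpDynamics

theorem theorem1 :
    (∀ lam : ℂ, ExpDynamics.Admissible lam →
      (∃ μ : Measure ℂ, SigmaFinite μ ∧ ExpDynamics.IsACInvariant (ExpDynamics.expMap lam) μ) ∧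
      ¬ ∃ μ : Measure ℂ, IsProbabilityMeasure μ ∧
          ExpDynamics.IsACInvariant (ExpDynamics.expMap lam) μ) ∧
    ExpDynamics.Admissible (2 * Real.pi * Complex.I) := by
  refine ⟨fun lam h => ?_, ExpDynamics.admissible_tau⟩
  obtain ⟨a, r, hr, hd, hE⟩ := ExpDynamics.exists_recurrentSet_pos h.pos_measure
  have hconn := ExpDynamics.isPreconnected_compl_postOrbit h.julia_eq h.orbit_bounded
  exact ⟨ExpDynamics.exists_sigmaFinite_isACInvariant h.ne_zero hr hd hE,
    ExpDynamics.not_exists_isACInvariant_probability h.ne_zero h.orbit_bounded hconn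
      (ExpDynamics.volume_postOrbit_eq_zero h.ne_zero h.orbit_bounded hconn hr hd hE)⟩
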